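/- Let $n\ge 1$, let $f:\mathbb R^{n-1}\to\mathbb R$ be continuous and let $A\subset\mathbb R^{n-1}$ be open with $f>0$ in $A$ and $f=0$ on $\partial A$. Put $$\Omega=\{(x',t)\in\mathbb R^n:\ x'\in A,\ 0<t<f(x')\}.$$ Let $\sigma\in L^\infty(\partial\Omega)$ be real-valued with $\sigma=0$ on $\partial\Omega\setminus (A\times\{0\})$, write $\sigma(x')=\sigma(x',0)$ for $x'\in A$, and let $A_\pm=\{x'\in A:\ \pm\sigma(x')>0\}$. For $x'\in A_-$ let $-\mu(x')$ be the first positive solution of $$-\sigma(x')=\sqrt{-\mu(x')}\,\tanh\big(f(x')\sqrt{-\mu(x')}\big);$$ this solution exists, and $\mu(x')$ is the lowest eigenvalue of $-\frac{d^2}{dt^2}$ on $(0,f(x'))$ with the Robin condition $-\varphi'(0)+\sigma(x')\varphi(0)=0$ and the Neumann condition $\varphi'(f(x'))=0$. Put $$\rho(x',t)=\tfrac12\Big(f(x')+\tfrac1{2\sigma(x')}\Big)^{-2}\chi_{A_+}(x')+\mu(x')\,\chi_{A_-}(x').$$ Then every $u\in H^1(\Omega)$ has a trace $u(\cdot,0)$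 on the base $A\times\{0\}$, which is locally integrable on $A$, and $$\int_\Omega|\nabla u|^2\,dx+\int_{A}\sigma(x')\,|u(x',0)|^2\,dx'\ \ge\ \int_\Omega\rho(x)\,|u(x)|^2\,dx+\frac12\int_{A_+}\Big(f(x')+\tfrac1{2\sigma(x')}\Big)^{-1}|u(x',0)|^2\,dx',$$ where the second term on the left is the boundary term $\int_{\partial\Omega}\sigma|u|^2\,d\nu$. If $\int_A|\sigma(x')|\,|u(x',0)|^2\,dx'<\infty$, all four integrals converge absolutely and the inequality holds as written. For arbitrary $u\in H^1(\Omega)$, it holds in $[0,\infty]$ after the contributions of the negative parts of $\sigma|u(\cdot,0)|^2$ and of $\rho|u|^2$ have been moved to the other side. -/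

import Mathlib

open Set MeasureTheory
open scoped ContDiff

namespace RobinHardy

/-- The horizontal space `ℝ^(n-1)`, with `d = n - 1`. -/
abbrev Base (d : ℕ) := EuclideanSpace ℝ (Fin d)

/-- Points `x = (x', t)` of `ℝ^n = ℝ^(n-1) × ℝ`. The measure is Lebesgue measure; the norm of the
product type is never used (only its topology and smooth structure). -/
abbrev Pt (d : ℕ) := Base d × ℝ

/-- The coordinate directions of `ℝ^n`: `some i` are the horizontal ones, `none` is the vertical
one. -/
noncomputable def dir {d : ℕ} : Option (Fin d) → Pt d
  | some i => (EuclideanSpace.single i 1, 0)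
  | none => (0, 1)

/-- The region `{(x', t) : x' ∈ A, 0 < t < f x'}` under the graph of `f`. -/
def region {d : ℕ} (A : Set (Base d)) (f : Base d → ℝ) : Set (Pt d) :=
  {x | x.1 ∈ A ∧ 0 < x.2 ∧ x.2 < f x.1}

/-- `v` is the weak partial derivative of `u` on `Ω` in the coordinate direction `j`. -/
def IsWeakPartial {d : ℕ} (Ω : Set (Pt d)) (j : Option (Fin d)) (u v : Pt d → ℂ) : Prop :=
  ∀ φ : Pt d → ℝ, ContDiff ℝ ∞ φ → HasCompactSupport φ → tsupport φ ⊆ Ω →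
    ∫ x in Ω, (fderiv ℝ φ x (dir j)) • u x = -∫ x in Ω, φ x • v x

/-- `u ∈ H¹(Ω)`, with weak gradient `G`: `u` and all its weak first partial derivatives `G j` are
square integrable on `Ω`. -/
structure IsH1 {d : ℕ} (Ω : Set (Pt d)) (u : Pt d → ℂ) (G : Option (Fin d) → Pt d → ℂ) : Prop where
  memLp : MemLp u 2 (volume.restrict Ω)
  memLp_grad : ∀ j, MemLp (G j) 2 (volume.restrict Ω)
  weak : ∀ j, IsWeakPartial Ω j u (G j)

/-- `g = u(·, 0)` is the trace of `u` on the base `A × {0}` of the region under the graph of `f`,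
where `v` is the weak vertical derivative of `u`: `g` is locally integrable on `A`, and the
Gauss–Green formula holds for all smooth test functions that vanish near the
rest of the boundary (the outer unit normal on the base is `(0, -1)`, and the surface measure there
is Lebesgue measure on `A`). This determines `g` almost everywhere on `A`. -/
structure IsBaseTrace {d : ℕ} (A : Set (Base d)) (f : Base d → ℝ) (u v : Pt d → ℂ)
    (g : Base d → ℂ) : Prop where
  locallyIntegrableOn : LocallyIntegrableOn g A
  green : ∀ φ : Pt d → ℝ, ContDiff ℝ ∞ φ → HasCompactSupport φ →
    tsupport φ ⊆ {x | x.1 ∈ A ∧ x.2 < f x.1} →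
    ∫ x in region A f, (fderiv ℝ φ x (dir none)) • u x =
      -(∫ x in region A f, φ x • v x) - ∫ y in A, φ (y, 0) • g y

/-- The set `A₊` of points of `A` where `σ > 0`. -/
def baseSetPos {d : ℕ} (A : Set (Base d)) (σ : Base d → ℝ) : Set (Base d) := {y | y ∈ A ∧ 0 < σ y}

/-- The set `A₋` of points of `A` where `σ < 0`. -/
def baseSetNeg {d : ℕ} (A : Set (Base d)) (σ : Base d → ℝ) : Set (Base d) := {y | y ∈ A ∧ σ y < 0}

/-- The positive solutions `m` of `-s = √m * tanh (b √m)`. -/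
noncomputable def tanhSolutions (b s : ℝ) : Set ℝ :=
  {m | 0 < m ∧ -s = Real.sqrt m * Real.tanh (b * Real.sqrt m)}

/-- The number `μ` such that `-μ` is the first positive solution `m` of `-s = √m * tanh (b √m)`. -/
noncomputable def mu (b s : ℝ) : ℝ := -sInf (tanhSolutions b s)

/-- `lam` is an eigenvalue of `-d²/dt²` on `(0, b)` with Robin condition `-φ'(0) + s φ(0) = 0` at
`0` and Neumann condition `φ'(b) = 0` at `b`; here `ψ = φ'`. -/
def IsRobinNeumannEigenvalue (b s lam : ℝ) : Prop :=
  ∃ φ ψ : ℝ → ℝ,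
    (∀ t ∈ Icc 0 b, HasDerivWithinAt φ (ψ t) (Icc 0 b) t) ∧
    (∀ t ∈ Icc 0 b, HasDerivWithinAt ψ (-(lam * φ t)) (Icc 0 b) t) ∧
    -ψ 0 + s * φ 0 = 0 ∧ ψ b = 0 ∧ ∃ t ∈ Icc 0 b, φ t ≠ 0

/-- The weight `ρ(x', t) = ½ (f(x') + 1/(2σ(x')))⁻² χ_{A₊}(x') + μ(x') χ_{A₋}(x')`. -/
noncomputable def rho {d : ℕ} (A : Set (Base d)) (f σ : Base d → ℝ) (x : Pt d) : ℝ :=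
  (baseSetPos A σ).indicator (fun y => 1 / 2 * ((f y + 1 / (2 * σ y)) ^ 2)⁻¹) x.1 +
    (baseSetNeg A σ).indicator (fun y => mu (f y) (σ y)) x.1

/-- The squared length `|∇u(x)|²` of a gradient. -/
noncomputable def gradSq {d : ℕ} (G : Option (Fin d) → Pt d → ℂ) (x : Pt d) : ℝ :=
  ∑ j, ‖G j x‖ ^ 2

end RobinHardy

open RobinHardy

namespace RobinHardy

open Filter Topology

/-! The inequality is one-dimensional. Since `|∇u|² ≥ |∂ₜu|²`, it is enough to prove it on almost
every vertical fibre `(0, b)`, `b = f(x')`, and to integrate over `A`.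

On a fibre, let `p` be absolutely continuous with `p(0) = c`, and let `w` satisfy the Riccati
inequality `w' + w² ≤ -κ` with `w(b) ≥ 0`. Integrating `0 ≤ (p' - wp)² = p'² - (wp²)' + (w' + w²)p²`
gives `κ ∫ p² ≤ ∫ p'² + w(0)c²` (`weighted_fiber`). For `σ > 0` an explicit rational `w` gives both
the weight and the boundary gain (`fiber_ineq_pos`); for `σ < 0`, `w` is the logarithmic derivative
of the ground state `cosh(√(-μ)(b - t))`, which solves the Riccati equation exactly
(`fiber_ineq_neg`). The same `w` shows that no eigenvalue lies below `μ`.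

The fibres of `u ∈ H¹` are reached through `IsH1.exists_trace`: the difference between `u` and the
vertical primitive of `∂ₜu` is independent of the height, because every test function with zero
vertical integrals is the vertical derivative of a test function (`exists_base_value`). This
difference is the trace, and the Gauss–Green formula determines it (`IsBaseTrace.ae_eq`).

Integration is done with positive and negative parts separated, so that the extended inequality
needs no finiteness. For the ordinary inequality the negative part of `ρ|u|²` must be finite;
`neg_mu_mul_le` bounds it on fibres by the energy, the boundary term and a multiple of `σ²|u|²`, and
`σ` is bounded. -/

/-! ### One-dimensional inequalities from Riccati subsolutions -/

lemma acOn_const_add_integral {b c : ℝ} {v : ℝ → ℝ} (hv : IntervalIntegrable v volume 0 b) :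
    AbsolutelyContinuousOnInterval (fun t => c + ∫ s in (0:ℝ)..t, v s) 0 b :=
  ((contDiff_const (c := c)).contDiffOn (n := 1)).absolutelyContinuousOnInterval.add
    (hv.absolutelyContinuousOnInterval_intervalIntegral left_mem_uIcc)

lemma ae_deriv_const_add_integral {b c : ℝ} {v : ℝ → ℝ} (hv : IntervalIntegrable v volume 0 b) :
    ∀ᵐ t, t ∈ uIcc 0 b → HasDerivAt (fun t => c + ∫ s in (0:ℝ)..t, v s) (v t) t := by
  filter_upwards [hv.ae_hasDerivAt_integral] with t ht h
  exact (ht h 0 left_mem_uIcc).const_add c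

lemma integral_deriv_mul_primitive {b : ℝ} {φ v : ℝ → ℝ} (hφ : ContDiff ℝ 1 φ)
    (hv : IntervalIntegrable v volume 0 b) (c : ℝ) :
    ∫ t in (0:ℝ)..b, deriv φ t * (c + ∫ s in (0:ℝ)..t, v s) =
      φ b * (c + ∫ s in (0:ℝ)..b, v s) - φ 0 * c - ∫ t in (0:ℝ)..b, φ t * v t := by
  have h := (acOn_const_add_integral (c := c) hv).integral_mul_deriv_eq_deriv_mul
    (hφ.contDiffOn.absolutelyContinuousOnInterval (a := 0) (b := b))
  have h2 : ∫ t in (0:ℝ)..b, deriv (fun t => c + ∫ s in (0:ℝ)..t, v s) t * φ t =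
      ∫ t in (0:ℝ)..b, φ t * v t := by
    apply intervalIntegral.integral_congr_ae
    filter_upwards [ae_deriv_const_add_integral (c := c) hv] with t ht h
    rw [(ht (uIoc_subset_uIcc h)).deriv, mul_comm]
  rw [h2] at h
  simp only [intervalIntegral.integral_same, add_zero] at h
  simp_rw [mul_comm (deriv φ _)]
  rw [h]; ring

/-- Complete the square: `(v - wp)² ≥ 0` for the primitive `p` of `v`, and integrate the total
derivative of `w p²`. The endpoint term at `b` is dropped because `w b ≥ 0`. -/
lemma weighted_fiber_real {b c κ : ℝ} (hb : 0 ≤ b) {v w : ℝ → ℝ}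
    (hv : IntervalIntegrable v volume 0 b)
    (hv2 : IntervalIntegrable (fun t => v t ^ 2) volume 0 b)
    (hw : ContDiffOn ℝ 1 w (uIcc 0 b)) (hwb : 0 ≤ w b)
    (hκ : ∀ t ∈ Ioo 0 b, deriv w t + w t ^ 2 ≤ -κ) :
    κ * ∫ t in (0:ℝ)..b, (c + ∫ s in (0:ℝ)..t, v s) ^ 2 ≤
      (∫ t in (0:ℝ)..b, v t ^ 2) + w 0 * c ^ 2 := by
  set p : ℝ → ℝ := fun t => c + ∫ s in (0:ℝ)..t, v s with hp
  have hpac : AbsolutelyContinuousOnInterval p 0 b := acOn_const_add_integral hv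
  have hwac := hw.absolutelyContinuousOnInterval
  have hF := hwac.mul (hpac.mul hpac)
  have hint := hF.integral_deriv_eq_sub
  have hp0 : p 0 = c := by simp [hp]
  have hpc : ContinuousOn p (uIcc 0 b) := hpac.continuousOn
  have hle : ∫ t in (0:ℝ)..b, κ * p t ^ 2 ≤
      ∫ t in (0:ℝ)..b, (v t ^ 2 - deriv (w * (p * p)) t) := by
    refine intervalIntegral.integral_mono_ae_restrict hb
      ((hpc.pow 2).const_smul κ).intervalIntegrable (hv2.sub hF.intervalIntegrable_deriv) ?_
    rw [Filter.EventuallyLE, ae_restrict_iff' measurableSet_Icc]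
    filter_upwards [ae_deriv_const_add_integral (c := c) hv, hwac.ae_differentiableAt,
      Measure.ae_ne volume 0, Measure.ae_ne volume b] with t h1 h2 h3 h4 ht
    rw [← uIcc_of_le hb] at ht
    have h5 := hκ t ⟨lt_of_le_of_ne (uIcc_of_le hb ▸ ht).1 h3.symm,
      lt_of_le_of_ne (uIcc_of_le hb ▸ ht).2 h4⟩
    rw [((h2 ht).hasDerivAt.mul ((h1 ht).mul (h1 ht))).deriv]
    simp only [Pi.mul_apply]
    change κ * p t ^ 2 ≤ v t ^ 2 - (deriv w t * (p t * p t) + w t * (v t * p t + p t * v t))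
    nlinarith [sq_nonneg (v t - w t * p t), mul_nonneg (sub_nonneg.2 h5) (sq_nonneg (p t))]
  rw [intervalIntegral.integral_sub hv2 hF.intervalIntegrable_deriv, hint,
    intervalIntegral.integral_const_mul] at hle
  simp only [Pi.mul_apply, hp0] at hle
  nlinarith [mul_nonneg hwb (mul_self_nonneg (p b))]

lemma intervalIntegrable_re {b : ℝ} {v : ℝ → ℂ} (hv : IntervalIntegrable v volume 0 b) :
    IntervalIntegrable (fun t => (v t).re) volume 0 b :=
  ⟨hv.1.re, hv.2.re⟩

lemma intervalIntegrable_im {b : ℝ} {v : ℝ → ℂ} (hv : IntervalIntegrable v volume 0 b) :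
    IntervalIntegrable (fun t => (v t).im) volume 0 b :=
  ⟨hv.1.im, hv.2.im⟩

lemma re_primitive {b t : ℝ} {v : ℝ → ℂ} (hv : IntervalIntegrable v volume 0 b) (c : ℂ)
    (ht : t ∈ uIcc 0 b) :
    (c + ∫ s in (0:ℝ)..t, v s).re = c.re + ∫ s in (0:ℝ)..t, (v s).re := by
  have h := Complex.reCLM.intervalIntegral_comp_comm
    (hv.mono_set (uIcc_subset_uIcc left_mem_uIcc ht))
  simp only [Complex.reCLM_apply] at h
  rw [Complex.add_re, h]

lemma im_primitive {b t : ℝ} {v : ℝ → ℂ} (hv : IntervalIntegrable v volume 0 b) (c : ℂ)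
    (ht : t ∈ uIcc 0 b) :
    (c + ∫ s in (0:ℝ)..t, v s).im = c.im + ∫ s in (0:ℝ)..t, (v s).im := by
  have h := Complex.imCLM.intervalIntegral_comp_comm
    (hv.mono_set (uIcc_subset_uIcc left_mem_uIcc ht))
  simp only [Complex.imCLM_apply] at h
  rw [Complex.add_im, h]

lemma continuousOn_primitive {b : ℝ} {v : ℝ → ℂ} (hv : IntervalIntegrable v volume 0 b) (c : ℂ) :
    ContinuousOn (fun t => c + ∫ s in (0:ℝ)..t, v s) (uIcc 0 b) :=
  continuousOn_const.add
    (intervalIntegral.continuousOn_primitive_interval' hv left_mem_uIcc)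

/-- Integration by parts against the primitive of an integrable complex function. -/
lemma integral_deriv_smul_primitive {b : ℝ} {φ : ℝ → ℝ} {v : ℝ → ℂ} (hφ : ContDiff ℝ 1 φ)
    (hv : IntervalIntegrable v volume 0 b) (c : ℂ) :
    ∫ t in (0:ℝ)..b, deriv φ t • (c + ∫ s in (0:ℝ)..t, v s) =
      φ b • (c + ∫ s in (0:ℝ)..b, v s) - φ 0 • c - ∫ t in (0:ℝ)..b, φ t • v t := by
  have hd : Continuous (deriv φ) := hφ.continuous_deriv le_rfl
  have hI1 : IntervalIntegrable (fun t => deriv φ t • (c + ∫ s in (0:ℝ)..t, v s)) volume 0 b :=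
    (hd.continuousOn.smul (continuousOn_primitive hv c)).intervalIntegrable
  have hI2 : IntervalIntegrable (fun t => φ t • v t) volume 0 b :=
    hv.continuousOn_smul hφ.continuous.continuousOn
  apply Complex.ext
  · have h := Complex.reCLM.intervalIntegral_comp_comm hI1
    have h2 := Complex.reCLM.intervalIntegral_comp_comm hI2
    simp only [Complex.reCLM_apply, Complex.real_smul, Complex.re_ofReal_mul] at h h2
    simp only [Complex.real_smul, Complex.sub_re, Complex.re_ofReal_mul, ← h, ← h2,
      re_primitive hv c right_mem_uIcc]
    rw [← integral_deriv_mul_primitive hφ (intervalIntegrable_re hv)]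
    exact intervalIntegral.integral_congr fun t ht => by
      simp only [re_primitive hv c ht]
  · have h := Complex.imCLM.intervalIntegral_comp_comm hI1
    have h2 := Complex.imCLM.intervalIntegral_comp_comm hI2
    simp only [Complex.imCLM_apply, Complex.real_smul, Complex.im_ofReal_mul] at h h2
    simp only [Complex.real_smul, Complex.sub_im, Complex.im_ofReal_mul, ← h, ← h2,
      im_primitive hv c right_mem_uIcc]
    rw [← integral_deriv_mul_primitive hφ (intervalIntegrable_im hv)]
    exact intervalIntegral.integral_congr fun t ht => by
      simp only [im_primitive hv c ht]

/-- Weighted one-dimensional inequality with a Riccati subsolution `w`. -/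
lemma weighted_fiber {b κ : ℝ} {c : ℂ} (hb : 0 ≤ b) {v : ℝ → ℂ} {w : ℝ → ℝ}
    (hv : IntervalIntegrable v volume 0 b)
    (hv2 : IntervalIntegrable (fun t => ‖v t‖ ^ 2) volume 0 b)
    (hw : ContDiffOn ℝ 1 w (uIcc 0 b)) (hwb : 0 ≤ w b)
    (hκ : ∀ t ∈ Ioo 0 b, deriv w t + w t ^ 2 ≤ -κ) :
    κ * ∫ t in (0:ℝ)..b, ‖c + ∫ s in (0:ℝ)..t, v s‖ ^ 2 ≤
      (∫ t in (0:ℝ)..b, ‖v t‖ ^ 2) + w 0 * ‖c‖ ^ 2 := by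
  have hsq : ∀ z : ℂ, ‖z‖ ^ 2 = z.re ^ 2 + z.im ^ 2 := fun z => by
    rw [Complex.sq_norm, Complex.normSq_apply]; ring
  have hre2 : IntervalIntegrable (fun t => (v t).re ^ 2) volume 0 b := by
    refine hv2.mono_fun ((intervalIntegrable_re hv).aestronglyMeasurable_restrict_uIoc.pow 2)
      (Filter.Eventually.of_forall fun t => ?_)
    simp only [Real.norm_eq_abs, abs_pow, sq_abs, hsq]
    exact (le_add_of_nonneg_right (sq_nonneg _)).trans (le_abs_self _)
  have him2 : IntervalIntegrable (fun t => (v t).im ^ 2) volume 0 b := by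
    refine hv2.mono_fun ((intervalIntegrable_im hv).aestronglyMeasurable_restrict_uIoc.pow 2)
      (Filter.Eventually.of_forall fun t => ?_)
    simp only [Real.norm_eq_abs, abs_pow, sq_abs, hsq]
    exact (le_add_of_nonneg_left (sq_nonneg _)).trans (le_abs_self _)
  -- Both sides are sums over real and imaginary parts, so the real inequality is applied to each.
  have h1 := weighted_fiber_real (c := c.re) hb (intervalIntegrable_re hv) hre2 hw hwb hκ
  have h2 := weighted_fiber_real (c := c.im) hb (intervalIntegrable_im hv) him2 hw hwb hκ
  have hcr : ContinuousOn (fun t => (c.re + ∫ s in (0:ℝ)..t, (v s).re) ^ 2) (uIcc 0 b) :=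
    (acOn_const_add_integral (intervalIntegrable_re hv)).continuousOn.pow 2
  have hci : ContinuousOn (fun t => (c.im + ∫ s in (0:ℝ)..t, (v s).im) ^ 2) (uIcc 0 b) :=
    (acOn_const_add_integral (intervalIntegrable_im hv)).continuousOn.pow 2
  have e1 : ∫ t in (0:ℝ)..b, ‖c + ∫ s in (0:ℝ)..t, v s‖ ^ 2 =
      (∫ t in (0:ℝ)..b, (c.re + ∫ s in (0:ℝ)..t, (v s).re) ^ 2) +
        ∫ t in (0:ℝ)..b, (c.im + ∫ s in (0:ℝ)..t, (v s).im) ^ 2 := by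
    rw [← intervalIntegral.integral_add hcr.intervalIntegrable hci.intervalIntegrable]
    exact intervalIntegral.integral_congr fun t ht => by
      simp only [hsq, re_primitive hv c ht, im_primitive hv c ht]
  have e2 : ∫ t in (0:ℝ)..b, ‖v t‖ ^ 2 =
      (∫ t in (0:ℝ)..b, (v t).re ^ 2) + ∫ t in (0:ℝ)..b, (v t).im ^ 2 := by
    rw [← intervalIntegral.integral_add hre2 him2]
    exact intervalIntegral.integral_congr fun t ht => hsq _
  rw [e1, e2, hsq c]
  linarith

/-- Hardy type inequality on `(0, b)` with positive Robin coefficient `s`. -/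
lemma fiber_ineq_pos {b s : ℝ} {c : ℂ} (hb : 0 < b) (hs : 0 < s) {v : ℝ → ℂ}
    (hv : IntervalIntegrable v volume 0 b)
    (hv2 : IntervalIntegrable (fun t => ‖v t‖ ^ 2) volume 0 b) :
    1 / 2 * ((b + 1 / (2 * s)) ^ 2)⁻¹ * (∫ t in (0:ℝ)..b, ‖c + ∫ s in (0:ℝ)..t, v s‖ ^ 2) +
        1 / 2 * ((b + 1 / (2 * s))⁻¹ * ‖c‖ ^ 2) ≤
      (∫ t in (0:ℝ)..b, ‖v t‖ ^ 2) + s * ‖c‖ ^ 2 := by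
  set a := 1 / (2 * s) with ha
  have ha0 : 0 < a := by positivity
  set L := b + a with hL
  have hL0 : 0 < L := by positivity
  -- The shift `a = 1/(2s)` makes the first term of `w 0` equal to `s`; subtracting the constant
  -- makes `w b = 0`, and this constant is the gain at the boundary.
  have h := weighted_fiber (κ := 1 / 2 * (L ^ 2)⁻¹) (c := c)
    (w := fun t => 1 / 2 * (t + a)⁻¹ - 1 / 2 * L⁻¹) hb.le hv hv2 ?_ ?_ ?_
  · have : 1 / 2 * (0 + a)⁻¹ = s := by rw [ha]; field_simp; ring
    rw [this] at h
    linarith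
  · refine (contDiffOn_const.mul (ContDiffOn.inv (contDiffOn_id.add contDiffOn_const) ?_)).sub
      contDiffOn_const
    intro t ht
    rw [uIcc_of_le hb.le] at ht
    exact (by simp only [id]; linarith [ht.1] : 0 < id t + a).ne'
  · simp [hL]
  · intro t ht
    have ht0 : 0 < t + a := by linarith [ht.1]
    have htL : t + a ≤ L := by linarith [ht.2]
    have hd : HasDerivAt (fun t => 1 / 2 * (t + a)⁻¹ - 1 / 2 * L⁻¹)
        (1 / 2 * (-1 / (t + a) ^ 2)) t :=
      ((((hasDerivAt_id t).add_const a).inv ht0.ne').const_mul (1 / 2)).sub_const _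
    rw [hd.deriv]
    have hinv : L⁻¹ ≤ (t + a)⁻¹ := inv_anti₀ ht0 htL
    have hL1 : 0 < L⁻¹ := by positivity
    have e : -1 / (t + a) ^ 2 = -((t + a)⁻¹) ^ 2 := by field_simp
    rw [e, ← inv_pow]
    -- With `x = (t + a)⁻¹ ≥ y = L⁻¹`, the quantity `w' + w² + y²/2` equals `-(x - y)(x + 3y)/4`.
    nlinarith

/-- The function is `φ'/φ` for `φ(t) = cosh(√m (b - t))`, and `φ'' = mφ` turns into `w' = m - w²`.
-/
lemma hasDerivAt_neumannRiccati (b : ℝ) {m : ℝ} (hm : 0 ≤ m) (t : ℝ) : HasDerivAt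
    (fun t => -√m * (Real.sinh ((b - t) * √m) / Real.cosh ((b - t) * √m)))
    (m - (-√m * (Real.sinh ((b - t) * √m) / Real.cosh ((b - t) * √m))) ^ 2) t := by
  have hl : HasDerivAt (fun t => (b - t) * √m) (-1 * √m) t :=
    (((hasDerivAt_id t).const_sub b).mul_const (√m))
  have h := ((hl.sinh).div hl.cosh (Real.cosh_pos _).ne').const_mul (-√m)
  convert! h using 1
  have hc := (Real.cosh_pos ((b - t) * √m)).ne'
  field_simp
  rw [Real.sq_sqrt hm]
  ring

/-- Ground state inequality on `(0, b)` with Robin coefficient `-√m tanh (b √m)`. -/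
lemma fiber_ineq_neg {b m : ℝ} {c : ℂ} (hb : 0 < b) (hm : 0 < m) {v : ℝ → ℂ}
    (hv : IntervalIntegrable v volume 0 b)
    (hv2 : IntervalIntegrable (fun t => ‖v t‖ ^ 2) volume 0 b) :
    √m * Real.tanh (b * √m) * ‖c‖ ^ 2 ≤
      (∫ t in (0:ℝ)..b, ‖v t‖ ^ 2) + m * ∫ t in (0:ℝ)..b, ‖c + ∫ s in (0:ℝ)..t, v s‖ ^ 2 := by
  have hder := hasDerivAt_neumannRiccati b hm.le
  have h := weighted_fiber (κ := -m) (c := c)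
    (w := fun t => -√m * (Real.sinh ((b - t) * √m) / Real.cosh ((b - t) * √m))) hb.le hv hv2
    ?_ ?_ ?_
  · simp only [sub_zero, ← Real.tanh_eq_sinh_div_cosh] at h
    linarith
  · refine (contDiff_const.mul (ContDiff.div ?_ ?_ fun t => (Real.cosh_pos _).ne')).contDiffOn
    · exact Real.contDiff_sinh.comp ((contDiff_const.sub contDiff_id).mul contDiff_const)
    · exact Real.contDiff_cosh.comp ((contDiff_const.sub contDiff_id).mul contDiff_const)
  · simp
  · intro t _
    rw [(hder t).deriv]
    simp

/-! ### The implicit equation for `μ` and the Robin–Neumann eigenvalue -/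

lemma strictMono_tanh : StrictMono Real.tanh := by
  intro x y hxy
  rw [Real.tanh_eq_sinh_div_cosh, Real.tanh_eq_sinh_div_cosh,
    div_lt_div_iff₀ (Real.cosh_pos _) (Real.cosh_pos _)]
  have h : 0 < Real.sinh (y - x) := Real.sinh_pos_iff.2 (sub_pos.2 hxy)
  rw [Real.sinh_sub] at h
  linarith

lemma continuous_tanh : Continuous Real.tanh := by
  have : Real.tanh = fun x => Real.sinh x / Real.cosh x := by
    funext x; exact Real.tanh_eq_sinh_div_cosh x
  rw [this]
  exact Real.continuous_sinh.div Real.continuous_cosh fun x => (Real.cosh_pos x).ne'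

/-- After clearing denominators this is `1 + 2x ≤ exp (2x)`. It serves both the existence of `μ` and
the upper bounds on `-μ`. -/
lemma div_one_add_le_tanh {x : ℝ} (hx : 0 ≤ x) : x / (1 + x) ≤ Real.tanh x := by
  have h1 : x + 1 ≤ Real.exp x := Real.add_one_le_exp x
  have h2 : Real.exp x * Real.exp (-x) = 1 := by rw [← Real.exp_add]; simp
  have h3 : 2 * x + 1 ≤ Real.exp x * Real.exp x := by
    rw [← Real.exp_add, ← two_mul]; exact Real.add_one_le_exp _
  have h4 : 0 < Real.exp (-x) := Real.exp_pos _
  rw [Real.tanh_eq_sinh_div_cosh, div_le_div_iff₀ (by linarith) (Real.cosh_pos _),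
    Real.sinh_eq, Real.cosh_eq]
  have h5 : Real.exp (-x) * (2 * x + 1) ≤ Real.exp x := by
    calc Real.exp (-x) * (2 * x + 1) ≤ Real.exp (-x) * (Real.exp x * Real.exp x) := by gcongr
      _ = Real.exp x * (Real.exp x * Real.exp (-x)) := by ring
      _ = Real.exp x := by rw [h2, mul_one]
  linarith

/-- The function `m ↦ √m tanh (b √m)`. -/
noncomputable def sqrtTanh (b m : ℝ) : ℝ := √m * Real.tanh (b * √m)

lemma sqrtTanh_zero (b : ℝ) : sqrtTanh b 0 = 0 := by simp [sqrtTanh]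

lemma strictMonoOn_sqrtTanh {b : ℝ} (hb : 0 < b) : StrictMonoOn (sqrtTanh b) (Ici 0) := by
  intro x hx y _ hxy
  have h1 : √x < √y := Real.sqrt_lt_sqrt hx hxy
  have h2 : Real.tanh (b * √x) < Real.tanh (b * √y) :=
    strictMono_tanh (mul_lt_mul_of_pos_left h1 hb)
  have h3 : 0 ≤ Real.tanh (b * √x) := by
    rw [← Real.tanh_zero]
    exact strictMono_tanh.monotone (by positivity)
  exact mul_lt_mul'' h1 h2 (Real.sqrt_nonneg _) h3

lemma continuous_sqrtTanh (b : ℝ) : Continuous (sqrtTanh b) :=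
  Real.continuous_sqrt.mul
    (continuous_tanh.comp (continuous_const.mul Real.continuous_sqrt))

lemma exists_sqrtTanh_eq {b r : ℝ} (hb : 0 < b) (hr : 0 < r) : ∃ m, 0 < m ∧ sqrtTanh b m = r := by
  -- The root `2r + 1/b` is at least `2r`, and `b` times it is at least `1`, where `tanh ≥ 1/2`.
  have hbig : r ≤ sqrtTanh b ((r + r + b⁻¹) ^ 2) := by
    have hx : 0 < r + r + b⁻¹ := by positivity
    rw [sqrtTanh, Real.sqrt_sq hx.le]
    have h1 := div_one_add_le_tanh (x := b * (r + r + b⁻¹)) (by positivity)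
    have h2 : (1:ℝ) / 2 ≤ b * (r + r + b⁻¹) / (1 + b * (r + r + b⁻¹)) := by
      have : b * (r + r + b⁻¹) = 2 * (b * r) + 1 := by field_simp; ring
      rw [this, div_le_div_iff₀ (by positivity) (by positivity)]
      nlinarith [mul_pos hb hr]
    have h3 := mul_le_mul_of_nonneg_left (h2.trans h1) hx.le
    have : 0 < b⁻¹ := by positivity
    linarith
  obtain ⟨m, hm, hmr⟩ := intermediate_value_Icc (f := sqrtTanh b) (sq_nonneg (r + r + b⁻¹))
    (continuous_sqrtTanh b).continuousOn ⟨(sqrtTanh_zero b).symm ▸ hr.le, hbig⟩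
  refine ⟨m, lt_of_le_of_ne hm.1 ?_, hmr⟩
  rintro rfl
  rw [sqrtTanh_zero] at hmr
  exact hr.ne hmr

/-- Strict monotonicity of `m ↦ √m tanh (b√m)` makes the positive solution unique, so the first one
is the only one. -/
lemma exists_tanhSolutions_eq_singleton {b s : ℝ} (hb : 0 < b) (hs : s < 0) :
    ∃ m, 0 < m ∧ sqrtTanh b m = -s ∧ tanhSolutions b s = {m} := by
  obtain ⟨m, hm, hms⟩ := exists_sqrtTanh_eq hb (neg_pos.2 hs)
  refine ⟨m, hm, hms, Set.ext fun x => ⟨fun hx => ?_, ?_⟩⟩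
  · exact (strictMonoOn_sqrtTanh hb).injOn hx.1.le hm.le (hx.2.symm.trans hms.symm)
  · rintro rfl
    exact ⟨hm, hms.symm⟩

lemma neg_mu_spec {b s : ℝ} (hb : 0 < b) (hs : s < 0) :
    0 < -mu b s ∧ sqrtTanh b (-mu b s) = -s ∧ tanhSolutions b s = {-mu b s} := by
  obtain ⟨m, hm, hms, h⟩ := exists_tanhSolutions_eq_singleton hb hs
  have : -mu b s = m := by rw [mu, h, csInf_singleton, neg_neg]
  rw [this]
  exact ⟨hm, hms, h⟩

lemma isLeast_tanhSolutions {b s : ℝ} (hb : 0 < b) (hs : s < 0) :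
    IsLeast (tanhSolutions b s) (-mu b s) := by
  rw [(neg_mu_spec hb hs).2.2]
  exact isLeast_singleton

/-- Rewrites a sublevel condition on `-μ` as an explicit inequality, from which measurability of `μ`
follows. -/
lemma neg_mu_lt_iff {b s a : ℝ} (hb : 0 < b) (hs : s < 0) :
    -mu b s < a ↔ 0 < a ∧ -s < sqrtTanh b a := by
  obtain ⟨h0, h1, -⟩ := neg_mu_spec hb hs
  constructor
  · intro h
    refine ⟨h0.trans h, ?_⟩
    rw [← h1]
    exact strictMonoOn_sqrtTanh hb h0.le (h0.trans h).le h
  · rintro ⟨ha, h⟩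
    rw [← h1] at h
    exact ((strictMonoOn_sqrtTanh hb).lt_iff_lt h0.le ha.le).1 h

/-- `μ` is a Robin-Neumann eigenvalue, with eigenfunction `cosh (√(-μ) (b - t))`. -/
lemma isRobinNeumannEigenvalue_mu {b s : ℝ} (hb : 0 < b) (hs : s < 0) :
    IsRobinNeumannEigenvalue b s (mu b s) := by
  obtain ⟨h0, h1, -⟩ := neg_mu_spec hb hs
  set k := √(-mu b s) with hk
  have hk2 : k ^ 2 = -mu b s := Real.sq_sqrt h0.le
  have hl : ∀ t : ℝ, HasDerivAt (fun t => k * (b - t)) (k * -1) t := fun t =>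
    ((hasDerivAt_id t).const_sub b).const_mul k
  refine ⟨fun t => Real.cosh (k * (b - t)), fun t => -k * Real.sinh (k * (b - t)),
    fun t _ => ?_, fun t _ => ?_, ?_, by simp, b, right_mem_Icc.2 hb.le, by simp⟩
  · refine HasDerivAt.hasDerivWithinAt ?_
    convert! (hl t).cosh using 1
    ring
  · refine HasDerivAt.hasDerivWithinAt ?_
    convert! (hl t).sinh.const_mul (-k) using 1
    have : mu b s = -k ^ 2 := by rw [hk2, neg_neg]
    rw [this]; ring
  · have hs' : s = -sqrtTanh b (-mu b s) := by rw [h1, neg_neg]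
    have hc := (Real.cosh_pos (k * b)).ne'
    rw [hs', sqrtTanh, ← hk, mul_comm b k, Real.tanh_eq_sinh_div_cosh]
    simp only [sub_zero]
    field_simp
    ring

/-- For an eigenfunction `φ` put `F = φφ' - wφ²`. The boundary conditions give `F = 0` at both ends,
and `F' = (μ - lam)φ² + (φ' - wφ)²`. If `lam < μ`, then `F` is monotone, hence zero, and `F' = 0`
contradicts `φ ≠ 0` somewhere. -/
lemma mu_le_of_isRobinNeumannEigenvalue {b s lam : ℝ} (hb : 0 < b) (hs : s < 0)
    (h : IsRobinNeumannEigenvalue b s lam) : mu b s ≤ lam := by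
  by_contra! hlt
  obtain ⟨φ, ψ, hφ, hψ, hR, hN, t₀, ht₀, hne⟩ := h
  obtain ⟨h0, h1, -⟩ := neg_mu_spec hb hs
  set m := -mu b s with hm
  set w : ℝ → ℝ := fun t => -√m * (Real.sinh ((b - t) * √m) / Real.cosh ((b - t) * √m)) with hw
  have hder : ∀ t : ℝ, HasDerivAt w (m - w t ^ 2) t := hasDerivAt_neumannRiccati b h0.le
  have hw0 : w 0 = s := by
    have : w 0 = -sqrtTanh b m := by
      simp [hw, sqrtTanh, Real.tanh_eq_sinh_div_cosh]
    rw [this, h1, neg_neg]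
  have hwb : w b = 0 := by simp [hw]
  set F : ℝ → ℝ := fun t => φ t * ψ t - w t * (φ t * φ t) with hF
  have hFd : ∀ t ∈ Icc 0 b, HasDerivWithinAt F
      ((mu b s - lam) * φ t ^ 2 + (ψ t - w t * φ t) ^ 2) (Icc 0 b) t := by
    intro t ht
    have := ((hφ t ht).mul (hψ t ht)).sub
      ((hder t).hasDerivWithinAt.mul ((hφ t ht).mul (hφ t ht)))
    refine this.congr_deriv ?_
    rw [hm]; simp only [Pi.mul_apply]; ring
  have hF0 : F 0 = 0 := by
    simp only [hF, hw0]; linear_combination (-φ 0) * hR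
  have hFb : F b = 0 := by simp [hF, hwb, hN]
  have hFc : ContinuousOn F (Icc 0 b) := fun t ht => (hFd t ht).continuousWithinAt
  have hmono : MonotoneOn F (Icc 0 b) := by
    refine monotoneOn_of_hasDerivWithinAt_nonneg (convex_Icc 0 b) hFc
      (fun t ht => (hFd t (interior_subset ht)).mono interior_subset) fun t _ => ?_
    have := sub_pos.2 hlt
    positivity
  have hzero : ∀ t ∈ Icc 0 b, F t = 0 := fun t ht =>
    le_antisymm (hFb ▸ hmono ht (right_mem_Icc.2 hb.le) ht.2)
      (hF0 ▸ hmono (left_mem_Icc.2 hb.le) ht ht.1)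
  have hd := hFd t₀ ht₀
  have hd0 : HasDerivWithinAt F 0 (Icc 0 b) t₀ :=
    (hasDerivWithinAt_const t₀ _ (0:ℝ)).congr hzero (hzero t₀ ht₀)
  have hu := (uniqueDiffOn_Icc hb t₀ ht₀).eq_deriv _ hd hd0
  have hp : 0 < (mu b s - lam) * φ t₀ ^ 2 := mul_pos (sub_pos.2 hlt) (by positivity)
  nlinarith [sq_nonneg (ψ t₀ - w t₀ * φ t₀)]

/-- The mass of a function on `(0, b)` weighted with `-μ` is controlled by the Robin energy. -/
lemma neg_mu_mul_le {b s : ℝ} {c : ℂ} (hb : 0 < b) (hs : s < 0) {v : ℝ → ℂ}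
    (hv : IntervalIntegrable v volume 0 b)
    (hv2 : IntervalIntegrable (fun t => ‖v t‖ ^ 2) volume 0 b) :
    -mu b s * (∫ t in (0:ℝ)..b, ‖c + ∫ s in (0:ℝ)..t, v s‖ ^ 2) ≤
      8 * (∫ t in (0:ℝ)..b, ‖v t‖ ^ 2) + 8 * (-s * ‖c‖ ^ 2) +
        4 * s ^ 2 * ∫ t in (0:ℝ)..b, ‖c + ∫ s in (0:ℝ)..t, v s‖ ^ 2 := by
  obtain ⟨h0, h1, -⟩ := neg_mu_spec hb hs
  set m := -mu b s with hm
  set k := √m with hk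
  have hk0 : 0 < k := Real.sqrt_pos.2 h0
  have hk2 : k ^ 2 = m := Real.sq_sqrt h0.le
  have hV : 0 ≤ ∫ t in (0:ℝ)..b, ‖v t‖ ^ 2 :=
    intervalIntegral.integral_nonneg hb.le fun t _ => sq_nonneg _
  have hU : 0 ≤ ∫ t in (0:ℝ)..b, ‖c + ∫ s in (0:ℝ)..t, v s‖ ^ 2 :=
    intervalIntegral.integral_nonneg hb.le fun t _ => sq_nonneg _
  have hx0 : 0 < b * k := by positivity
  have hlow : k * (b * k / (1 + b * k)) ≤ -s := by
    rw [← h1, sqrtTanh, ← hk]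
    exact mul_le_mul_of_nonneg_left (div_one_add_le_tanh hx0.le) hk0.le
  have hc := sq_nonneg ‖c‖
  -- If `b√m ≤ 1`, then `tanh x ≥ x/2` gives `mb ≤ -2s`, and the mass is controlled by a
  -- Poincaré-type inequality. Otherwise `tanh ≥ 1/2` gives `m ≤ 4s²`.
  rcases le_total (b * k) 1 with hx | hx
  · have h2 : b * k / 2 ≤ b * k / (1 + b * k) :=
      div_le_div_of_nonneg_left hx0.le (by positivity) (by linarith)
    have h3 : m * b ≤ 2 * -s := by
      have := mul_le_mul_of_nonneg_left h2 hk0.le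
      rw [← hk2]; nlinarith
    -- An auxiliary Robin coefficient, unrelated to the given one: it makes the shift equal to `b`
    -- and the weight `1/(8b²)`.
    have h4 := fiber_ineq_pos (c := c) (s := 1 / (2 * b)) hb (by positivity) hv hv2
    have e : 1 / 2 * ((b + 1 / (2 * (1 / (2 * b)))) ^ 2)⁻¹ = 1 / (8 * b ^ 2) := by
      field_simp; ring
    rw [e] at h4
    set I := ∫ t in (0:ℝ)..b, ‖c + ∫ s in (0:ℝ)..t, v s‖ ^ 2
    set V := ∫ t in (0:ℝ)..b, ‖v t‖ ^ 2
    have h5 : 1 / (8 * b ^ 2) * I ≤ V + 1 / (2 * b) * ‖c‖ ^ 2 := by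
      have : 0 ≤ 1 / 2 * ((b + 1 / (2 * (1 / (2 * b))))⁻¹ * ‖c‖ ^ 2) := by positivity
      linarith
    have h6 : I ≤ 8 * b ^ 2 * V + 4 * b * ‖c‖ ^ 2 := by
      have := mul_le_mul_of_nonneg_left h5 (by positivity : 0 ≤ 8 * b ^ 2)
      have e1 : 8 * b ^ 2 * (1 / (8 * b ^ 2) * I) = I := by field_simp
      have e2 : 8 * b ^ 2 * (V + 1 / (2 * b) * ‖c‖ ^ 2) = 8 * b ^ 2 * V + 4 * b * ‖c‖ ^ 2 := by
        field_simp; ring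
      rwa [e1, e2] at this
    have h7 : m * b ^ 2 ≤ 1 := by rw [← hk2]; nlinarith
    have h8 := mul_le_mul_of_nonneg_left h6 h0.le
    have h9 := mul_le_mul_of_nonneg_right h7 hV
    have h10 := mul_le_mul_of_nonneg_right h3 hc
    have h11 : 0 ≤ 4 * s ^ 2 * I := by positivity
    nlinarith
  · have h2 : 1 / 2 ≤ b * k / (1 + b * k) := by
      rw [div_le_div_iff₀ (by positivity) (by positivity)]; linarith
    have h3 : k ≤ 2 * -s := by
      have := mul_le_mul_of_nonneg_left h2 hk0.le
      linarith
    have h4 : m ≤ 4 * s ^ 2 := by rw [← hk2]; nlinarith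
    have h5 := mul_le_mul_of_nonneg_right h4 hU
    have h6 : 0 ≤ -s * ‖c‖ ^ 2 := mul_nonneg (by linarith) hc
    linarith

/-! ### Fubini over the region under the graph -/

variable {d : ℕ} {A S : Set (Base d)} {f : Base d → ℝ}

lemma isOpen_region (hA : IsOpen A) (hf : Continuous f) : IsOpen (region A f) :=
  (hA.preimage continuous_fst).inter ((isOpen_lt continuous_const continuous_snd).inter
    (isOpen_lt continuous_snd (hf.comp continuous_fst)))

lemma measurableSet_region (hS : MeasurableSet S) (hf : Continuous f) :
    MeasurableSet (region S f) :=
  measurableSet_regionBetween measurable_const hf.measurable hS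

lemma region_mono (h : S ⊆ A) : region S f ⊆ region A f := fun _ hx => ⟨h hx.1, hx.2⟩

lemma indicator_region {E : Type*} [Zero E] (F : Pt d → E) (y : Base d) :
    (fun t => (region S f).indicator F (y, t)) =
      S.indicator (fun y => (Ioo 0 (f y)).indicator fun t => F (y, t)) y := by
  classical
  funext t
  by_cases hy : y ∈ S
  · rw [indicator_of_mem hy]
    by_cases ht : t ∈ Ioo 0 (f y)
    · rw [indicator_of_mem ht, indicator_of_mem (show (y, t) ∈ region S f from ⟨hy, ht⟩)]
    · rw [indicator_of_notMem ht,
        indicator_of_notMem (show (y, t) ∉ region S f from fun h => ht h.2)]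
  · rw [indicator_of_notMem hy,
      indicator_of_notMem (show (y, t) ∉ region S f from fun h => hy h.1)]
    rfl

lemma lintegral_region (hS : MeasurableSet S) (hf : Continuous f) {F : Pt d → ENNReal}
    (hF : AEMeasurable F (volume.restrict (region S f))) :
    ∫⁻ x in region S f, F x = ∫⁻ y in S, ∫⁻ t in Ioo 0 (f y), F (y, t) := by
  have hm := measurableSet_region hS hf
  rw [← lintegral_indicator hm, Measure.volume_eq_prod,
    lintegral_prod _ ((aemeasurable_indicator_iff hm).2 hF), ← lintegral_indicator hS]
  refine lintegral_congr fun y => ?_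
  rw [indicator_region]
  by_cases hy : y ∈ S
  · simp only [indicator_of_mem hy]
    rw [lintegral_indicator measurableSet_Ioo]
  · simp only [indicator_of_notMem hy]
    exact lintegral_zero

lemma integral_region {E : Type*} [NormedAddCommGroup E] [NormedSpace ℝ E]
    (hS : MeasurableSet S) (hf : Continuous f) {F : Pt d → E}
    (hF : IntegrableOn F (region S f)) :
    ∫ x in region S f, F x = ∫ y in S, ∫ t in Ioo 0 (f y), F (y, t) := by
  have hm := measurableSet_region hS hf
  have hi : Integrable ((region S f).indicator F) ((volume : Measure (Base d)).prod volume) :=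
    (integrable_indicator_iff hm).2 hF
  rw [← integral_indicator hm, Measure.volume_eq_prod, integral_prod _ hi,
    ← integral_indicator hS]
  refine integral_congr_ae (Eventually.of_forall fun y => ?_)
  simp only
  rw [indicator_region]
  by_cases hy : y ∈ S
  · simp only [indicator_of_mem hy]
    rw [integral_indicator measurableSet_Ioo]
  · simp [indicator_of_notMem hy]

lemma integrableOn_slice {E : Type*} [NormedAddCommGroup E]
    (hS : MeasurableSet S) (hf : Continuous f) {F : Pt d → E}
    (hF : IntegrableOn F (region S f)) :
    ∀ᵐ y ∂volume.restrict S, IntegrableOn (fun t => F (y, t)) (Ioo 0 (f y)) := by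
  have hm := measurableSet_region hS hf
  have hi : Integrable ((region S f).indicator F) ((volume : Measure (Base d)).prod volume) :=
    (integrable_indicator_iff hm).2 hF
  rw [ae_restrict_iff' hS]
  filter_upwards [hi.prod_right_ae] with y hy hyS
  rw [indicator_region, indicator_of_mem hyS] at hy
  exact (integrable_indicator_iff measurableSet_Ioo).1 hy

lemma integrableOn_integral_slice {E : Type*} [NormedAddCommGroup E] [NormedSpace ℝ E]
    (hS : MeasurableSet S) (hf : Continuous f) {F : Pt d → E}
    (hF : IntegrableOn F (region S f)) :
    IntegrableOn (fun y => ∫ t in Ioo 0 (f y), F (y, t)) S := by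
  have hm := measurableSet_region hS hf
  have hi : Integrable ((region S f).indicator F) ((volume : Measure (Base d)).prod volume) :=
    (integrable_indicator_iff hm).2 hF
  rw [← integrable_indicator_iff hS]
  refine hi.integral_prod_left.congr (Eventually.of_forall fun y => ?_)
  simp only
  rw [indicator_region]
  by_cases hy : y ∈ S
  · simp only [indicator_of_mem hy]
    rw [integral_indicator measurableSet_Ioo]
  · simp [indicator_of_notMem hy]

lemma ae_slice (hS : MeasurableSet S) (hf : Continuous f) {P : Pt d → Prop}
    (h : ∀ᵐ x ∂volume.restrict (region S f), P x) :
    ∀ᵐ y ∂volume.restrict S, ∀ᵐ t ∂volume.restrict (Ioo 0 (f y)), P (y, t) := by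
  rw [ae_restrict_iff' (measurableSet_region hS hf), Measure.volume_eq_prod] at h
  rw [ae_restrict_iff' hS]
  filter_upwards [Measure.ae_ae_of_ae_prod h] with y hy hyS
  rw [ae_restrict_iff' measurableSet_Ioo]
  filter_upwards [hy] with t ht htI
  exact ht ⟨hyS, htI⟩

lemma region_subset_prod {M : ℝ} (hM : ∀ y ∈ S, f y ≤ M) : region S f ⊆ S ×ˢ Ioo 0 M :=
  fun _ hx => ⟨hx.1, hx.2.1, hx.2.2.trans_le (hM _ hx.1)⟩

lemma exists_bound_on_compact (hS : IsCompact S) (hf : Continuous f) :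
    ∃ M, 0 ≤ M ∧ ∀ y ∈ S, f y ≤ M := by
  obtain ⟨M, hM⟩ := hS.bddAbove_image hf.continuousOn
  exact ⟨max M 0, le_max_right _ _, fun y hy =>
    (hM (mem_image_of_mem f hy)).trans (le_max_left _ _)⟩

lemma volume_region_lt_top (hS : IsCompact S) (hf : Continuous f) :
    volume (region S f) < ⊤ := by
  obtain ⟨M, -, hM⟩ := exists_bound_on_compact hS hf
  refine (measure_mono (region_subset_prod hM)).trans_lt ?_
  rw [Measure.volume_eq_prod, Measure.prod_prod]
  exact ENNReal.mul_lt_top hS.measure_lt_top measure_Ioo_lt_top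

lemma integrableOn_comp_fst {E : Type*} [NormedAddCommGroup E] (hS : IsCompact S)
    (hf : Continuous f) {g : Base d → E} (hg : IntegrableOn g S) :
    IntegrableOn (fun x : Pt d => g x.1) (region S f) := by
  obtain ⟨M, -, hM⟩ := exists_bound_on_compact hS hf
  refine IntegrableOn.mono_set ?_ (region_subset_prod hM)
  have : IsFiniteMeasure ((volume : Measure ℝ).restrict (Ioo 0 M)) :=
    ⟨by simp⟩
  rw [IntegrableOn, Measure.volume_eq_prod, ← Measure.prod_restrict]
  exact Integrable.comp_fst hg _

/-! ### Vertical primitives and the Gauss–Green formula -/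

/-- Integrability over the parts of the region above compact subsets of the base. -/
def BaseLocallyIntegrable {E : Type*} [NormedAddCommGroup E] (A : Set (Base d)) (f : Base d → ℝ)
    (F : Pt d → E) : Prop :=
  ∀ K ⊆ A, IsCompact K → IntegrableOn F (region K f)

/-- `A` may have infinite measure, but `f` is bounded on compact sets, so the region above them has
finite volume and `L² ⊆ L¹` there. -/
lemma BaseLocallyIntegrable.of_memLp {E : Type*} [NormedAddCommGroup E] (hf : Continuous f)
    {F : Pt d → E} (hF : MemLp F 2 (volume.restrict (region A f))) :
    BaseLocallyIntegrable A f F := by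
  intro K hK hKc
  have : IsFiniteMeasure ((volume : Measure (Pt d)).restrict (region K f)) :=
    ⟨by simpa using volume_region_lt_top hKc hf⟩
  exact (hF.mono_measure (Measure.restrict_mono (region_mono hK) le_rfl)).integrable (by norm_num)

/-- The vertical primitive of `v`, vanishing on the base. -/
noncomputable def vprim (v : Pt d → ℂ) (x : Pt d) : ℂ := ∫ s in Ioc 0 x.2, v (x.1, s)

lemma vprim_eq (v : Pt d → ℂ) (y : Base d) {t : ℝ} (ht : 0 ≤ t) :
    vprim v (y, t) = ∫ s in (0:ℝ)..t, v (y, s) := by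
  rw [vprim, intervalIntegral.integral_of_le ht]

lemma stronglyMeasurable_vprim {v : Pt d → ℂ} (hv : StronglyMeasurable v) :
    StronglyMeasurable (vprim v) := by
  have : vprim v = fun x : Pt d => ∫ s, {p : Pt d × ℝ | 0 < p.2 ∧ p.2 ≤ p.1.2}.indicator
      (fun p => v (p.1.1, p.2)) (x, s) := by
    funext x
    rw [vprim, ← integral_indicator measurableSet_Ioc]
    rfl
  rw [this]
  refine StronglyMeasurable.integral_prod_right
    (f := fun x s => {p : Pt d × ℝ | 0 < p.2 ∧ p.2 ≤ p.1.2}.indicator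
      (fun p => v (p.1.1, p.2)) (x, s)) ?_
  refine StronglyMeasurable.indicator ?_ ?_
  · exact hv.comp_measurable (by fun_prop)
  · exact (measurableSet_lt measurable_const measurable_snd).inter
      (measurableSet_le measurable_snd (by fun_prop))

/-- On each fibre the primitive is bounded by the `L¹` norm of `v`, so its integral is at most `f y`
times that norm. -/
lemma BaseLocallyIntegrable.vprim {v : Pt d → ℂ} (hf : Continuous f)
    (hv : StronglyMeasurable v) (hvi : BaseLocallyIntegrable A f v) :
    BaseLocallyIntegrable A f (vprim v) := by
  intro K hK hKc
  obtain ⟨M, hM0, hM⟩ := exists_bound_on_compact hKc hf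
  have hKm := hKc.measurableSet
  refine ⟨(stronglyMeasurable_vprim hv).aestronglyMeasurable, ?_⟩
  rw [HasFiniteIntegral, lintegral_region hKm hf
    (stronglyMeasurable_vprim hv).measurable.enorm.aemeasurable]
  have hfin : ∫⁻ x in region K f, ‖v x‖ₑ < ⊤ := (hvi K hK hKc).2
  rw [lintegral_region hKm hf hv.measurable.enorm.aemeasurable] at hfin
  refine lt_of_le_of_lt ?_ (ENNReal.mul_lt_top (ENNReal.ofReal_lt_top (r := M)) hfin)
  rw [← lintegral_const_mul' _ _ ENNReal.ofReal_ne_top]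
  refine setLIntegral_mono' hKm fun y hy => ?_
  calc ∫⁻ t in Ioo 0 (f y), ‖RobinHardy.vprim v (y, t)‖ₑ
      ≤ ∫⁻ t in Ioo 0 (f y), ∫⁻ s in Ioo 0 (f y), ‖v (y, s)‖ₑ := by
        refine setLIntegral_mono' measurableSet_Ioo fun t ht => ?_
        refine (enorm_integral_le_lintegral_enorm _).trans (lintegral_mono_set ?_)
        exact fun s hs => ⟨hs.1, hs.2.trans_lt ht.2⟩
    _ = (∫⁻ s in Ioo 0 (f y), ‖v (y, s)‖ₑ) * ENNReal.ofReal (f y) := by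
        rw [setLIntegral_const, Real.volume_Ioo, sub_zero]
    _ ≤ ENNReal.ofReal M * ∫⁻ s in Ioo 0 (f y), ‖v (y, s)‖ₑ := by
        rw [mul_comm]
        gcongr
        exact hM y hy

lemma deriv_vertical {φ : Pt d → ℝ} (hφ : Differentiable ℝ φ) (y : Base d) (t : ℝ) :
    HasDerivAt (fun t => φ (y, t)) (fderiv ℝ φ (y, t) (dir none)) t := by
  have h1 : HasDerivAt (fun t : ℝ => ((y, t) : Pt d)) (0, 1) t :=
    (hasDerivAt_const t y).prodMk (hasDerivAt_id t)
  exact (hφ (y, t)).hasFDerivAt.comp_hasDerivAt t h1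

lemma exists_norm_le_of_hasCompactSupport {φ : Pt d → ℝ} (hφ : Continuous φ)
    (hc : HasCompactSupport φ) : ∃ C, ∀ x, ‖φ x‖ ≤ C :=
  hφ.bounded_above_of_compact_support hc

lemma integrableOn_smul_bounded {α : Type*} [MeasurableSpace α] [TopologicalSpace α]
    [OpensMeasurableSpace α] [SecondCountableTopology α]
    {μ : Measure α} {s : Set α} {F : α → ℂ} (hF : IntegrableOn F s μ) {φ : α → ℝ}
    (hφ : Continuous φ) {C : ℝ} (hC : ∀ x, ‖φ x‖ ≤ C) :
    IntegrableOn (fun x => φ x • F x) s μ :=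
  Integrable.bdd_smul hF C hφ.aestronglyMeasurable (Eventually.of_forall hC)

/-- The horizontal projection of the support of a test function. -/
def shadow (φ : Pt d → ℝ) : Set (Base d) := Prod.fst '' tsupport φ

lemma isCompact_shadow {φ : Pt d → ℝ} (hc : HasCompactSupport φ) : IsCompact (shadow φ) :=
  IsCompact.image hc continuous_fst

lemma eq_zero_of_notMem_shadow {φ : Pt d → ℝ} {x : Pt d} (hx : x.1 ∉ shadow φ) : φ x = 0 :=
  image_eq_zero_of_notMem_tsupport fun h => hx ⟨x, h, rfl⟩

lemma fderiv_eq_zero_of_notMem_shadow {φ : Pt d → ℝ} {x : Pt d} (hx : x.1 ∉ shadow φ) :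
    fderiv ℝ φ x = 0 :=
  image_eq_zero_of_notMem_tsupport fun h => hx ⟨x, tsupport_fderiv_subset ℝ h, rfl⟩

lemma setIntegral_region_eq_shadow {E : Type*} [NormedAddCommGroup E] [NormedSpace ℝ E]
    {K : Set (Base d)} (hA : IsOpen A) (hf : Continuous f)
    (hK : K ⊆ A) {F : Pt d → E} (hF : ∀ x : Pt d, x.1 ∉ K → F x = 0) :
    ∫ x in region A f, F x = ∫ x in region K f, F x :=
  setIntegral_eq_of_subset_of_forall_sdiff_eq_zero (measurableSet_region hA.measurableSet hf)
    (region_mono hK) fun x hx => hF x fun hxK => hx.2 ⟨hxK, hx.1.2⟩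

lemma continuous_fderiv_dir {φ : Pt d → ℝ} (hφ : ContDiff ℝ ∞ φ) :
    Continuous fun x => fderiv ℝ φ x (dir none) :=
  (hφ.continuous_fderiv (by simp)).clm_apply continuous_const

lemma hasCompactSupport_fderiv_dir {φ : Pt d → ℝ} (hc : HasCompactSupport φ) :
    HasCompactSupport fun x => fderiv ℝ φ x (dir none) :=
  (hc.fderiv ℝ).comp_left (g := fun L : Pt d →L[ℝ] ℝ => L (dir none)) (by simp)

/-- Gauss-Green formula for a function that is fibrewise a primitive of `v` with initial
value `g`. -/
lemma green_of_representation (hA : IsOpen A) (hf : Continuous f) (hfpos : ∀ y ∈ A, 0 < f y)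
    {u v : Pt d → ℂ} {g : Base d → ℂ} (hu : BaseLocallyIntegrable A f u)
    (hv : BaseLocallyIntegrable A f v) (hg : LocallyIntegrableOn g A)
    (hrep : ∀ᵐ y ∂volume.restrict A, ∀ᵐ t ∂volume.restrict (Ioo 0 (f y)),
      u (y, t) = g y + ∫ s in (0:ℝ)..t, v (y, s))
    {φ : Pt d → ℝ} (hφ : ContDiff ℝ ∞ φ) (hc : HasCompactSupport φ)
    (hs : tsupport φ ⊆ {x | x.1 ∈ A ∧ x.2 < f x.1}) :
    ∫ x in region A f, (fderiv ℝ φ x (dir none)) • u x =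
      -(∫ x in region A f, φ x • v x) - ∫ y in A, φ (y, 0) • g y := by
  set K := shadow φ with hK
  have hKc : IsCompact K := isCompact_shadow hc
  have hKA : K ⊆ A := by rintro _ ⟨x, hx, rfl⟩; exact (hs hx).1
  have hKm := hKc.measurableSet
  rw [setIntegral_region_eq_shadow hA hf hKA fun x hx => by
      rw [fderiv_eq_zero_of_notMem_shadow hx]; simp,
    setIntegral_region_eq_shadow hA hf hKA fun x hx => by
      rw [eq_zero_of_notMem_shadow hx, zero_smul],
    setIntegral_eq_of_subset_of_forall_sdiff_eq_zero hA.measurableSet hKA fun y hy => by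
      rw [eq_zero_of_notMem_shadow (x := (y, 0)) hy.2, zero_smul]]
  obtain ⟨C, hC⟩ := exists_norm_le_of_hasCompactSupport hφ.continuous hc
  obtain ⟨C', hC'⟩ := exists_norm_le_of_hasCompactSupport (continuous_fderiv_dir hφ)
    (hasCompactSupport_fderiv_dir hc)
  have hi1 := integrableOn_smul_bounded (hu K hKA hKc) (continuous_fderiv_dir hφ) hC'
  have hi2 := integrableOn_smul_bounded (hv K hKA hKc) hφ.continuous hC
  have hi3 : IntegrableOn (fun y => φ (y, 0) • g y) K :=
    integrableOn_smul_bounded (hg.integrableOn_compact_subset hKA hKc)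
      (hφ.continuous.comp (by fun_prop : Continuous fun y : Base d => ((y, 0) : Pt d)))
      (fun y => hC (y, 0))
  have hi4 : IntegrableOn (fun y => -∫ t in Ioo 0 (f y), φ (y, t) • v (y, t)) K :=
    (integrableOn_integral_slice hKm hf hi2).neg
  rw [integral_region hKm hf hi1, integral_region hKm hf hi2, ← integral_neg,
    ← integral_sub hi4 hi3]
  refine integral_congr_ae ?_
  filter_upwards [ae_restrict_of_ae_restrict_of_subset hKA hrep,
    integrableOn_slice hKm hf (hv K hKA hKc), ae_restrict_mem hKm] with y hy hvy hyK
  have hb := hfpos y (hKA hyK)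
  have hI : IntervalIntegrable (fun t => v (y, t)) volume 0 (f y) :=
    (intervalIntegrable_iff_integrableOn_Ioo_of_le hb.le).2 hvy
  have hφy : ContDiff ℝ 1 fun t => φ (y, t) :=
    (hφ.of_le (by simp)).comp (contDiff_const.prodMk contDiff_id)
  have hder : ∀ t, deriv (fun t => φ (y, t)) t = fderiv ℝ φ (y, t) (dir none) := fun t =>
    (deriv_vertical (hφ.differentiable (by simp)) y t).deriv
  have h := integral_deriv_smul_primitive hφy hI (g y)
  -- The support condition is strict at the top, so only the base contributes a boundary term.
  have hend : φ (y, f y) = 0 :=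
    image_eq_zero_of_notMem_tsupport fun h => lt_irrefl _ (hs h).2
  rw [hend, zero_smul, zero_sub, intervalIntegral.integral_of_le hb.le,
    intervalIntegral.integral_of_le hb.le, integral_Ioc_eq_integral_Ioo,
    integral_Ioc_eq_integral_Ioo] at h
  have h2 : ∫ t in Ioo 0 (f y), fderiv ℝ φ (y, t) (dir none) • u (y, t) =
      ∫ t in Ioo 0 (f y), deriv (fun t => φ (y, t)) t • (g y + ∫ s in (0:ℝ)..t, v (y, s)) := by
    refine integral_congr_ae ?_
    filter_upwards [hy] with t ht
    rw [ht, hder]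
  rw [h2, h]
  ring

/-! ### Uniqueness of the trace -/

/-- The trace on the base is unique. -/
lemma IsBaseTrace.ae_eq (hA : IsOpen A) (hf : Continuous f) (hfpos : ∀ y ∈ A, 0 < f y)
    {u v : Pt d → ℂ} {g g' : Base d → ℂ} (hg : IsBaseTrace A f u v g)
    (hg' : IsBaseTrace A f u v g') : ∀ᵐ y ∂volume.restrict A, g y = g' y := by
  rw [ae_restrict_iff' hA.measurableSet]
  have h := hA.ae_eq_zero_of_integral_contDiff_smul_eq_zero (f := fun y => g y - g' y)
    (μ := volume) (hg.locallyIntegrableOn.sub hg'.locallyIntegrableOn) ?_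
  · filter_upwards [h] with y hy hyA using sub_eq_zero.1 (hy hyA)
  intro η hη hηc hηA
  obtain ⟨ε, hε, hεf⟩ : ∃ ε, 0 < ε ∧ ∀ y ∈ tsupport η, ε ≤ f y := by
    rcases (tsupport η).eq_empty_or_nonempty with h | h
    · exact ⟨1, one_pos, by simp [h]⟩
    · obtain ⟨y, hy, hmin⟩ := IsCompact.exists_isMinOn hηc h hf.continuousOn
      exact ⟨f y, hfpos y (hηA hy), hmin⟩
  -- A vertical cutoff equal to `1` at height `0` and supported below `ε ≤ f`, so that `η(y)χ(t)` is
  -- admissible and restricts to `η` on the base.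
  let χ : ContDiffBump (0 : ℝ) := ⟨ε / 4, ε / 2, by positivity, by linarith⟩
  set φ : Pt d → ℝ := fun x => η x.1 * χ x.2 with hφ
  have hφs : ContDiff ℝ ∞ φ := (hη.comp contDiff_fst).mul (χ.contDiff.comp contDiff_snd)
  have hsub : tsupport φ ⊆ tsupport η ×ˢ Metric.closedBall 0 (ε / 2) := by
    refine closure_minimal ?_ ((isClosed_tsupport η).prod Metric.isClosed_closedBall)
    intro x hx
    have hx' : η x.1 * χ x.2 ≠ 0 := hx
    refine ⟨subset_tsupport η (left_ne_zero_of_mul hx'), ?_⟩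
    rw [← χ.tsupport_eq]
    exact subset_tsupport χ (right_ne_zero_of_mul hx')
  have hφc : HasCompactSupport φ :=
    (IsCompact.prod hηc (isCompact_closedBall 0 (ε / 2))).of_isClosed_subset
      (isClosed_tsupport φ) hsub
  have hφA : tsupport φ ⊆ {x | x.1 ∈ A ∧ x.2 < f x.1} := by
    intro x hx
    have hx' := hsub hx
    refine ⟨hηA hx'.1, ?_⟩
    have h1 := hεf _ hx'.1
    have h2 := hx'.2
    rw [Metric.mem_closedBall, Real.dist_eq, sub_zero] at h2
    linarith [le_abs_self x.2]
  have e := (hg.green φ hφs hφc hφA).symm.trans (hg'.green φ hφs hφc hφA)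
  have hφ0 : ∀ y, φ (y, 0) = η y := fun y => by
    simp only [hφ]
    rw [χ.one_of_mem_closedBall (Metric.mem_closedBall_self (by positivity)), mul_one]
  simp only [hφ0] at e
  obtain ⟨C, hC⟩ := hη.continuous.bounded_above_of_compact_support hηc
  have hint : ∀ {h : Base d → ℂ}, LocallyIntegrableOn h A →
      IntegrableOn (fun y => η y • h y) A := fun {h} hh =>
    IntegrableOn.of_forall_sdiff_eq_zero (integrableOn_smul_bounded
      (hh.integrableOn_compact_subset hηA hηc) hη.continuous hC) hA.measurableSet
      fun y hy => by rw [image_eq_zero_of_notMem_tsupport hy.2, zero_smul]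
  have hz : ∫ y, η y • (g y - g' y) = ∫ y in A, η y • (g y - g' y) := by
    refine (setIntegral_eq_integral_of_forall_compl_eq_zero fun y hy => ?_).symm
    rw [image_eq_zero_of_notMem_tsupport fun h => hy (hηA h), zero_smul]
  rw [hz]
  simp only [smul_sub]
  rw [integral_sub (hint hg.locallyIntegrableOn) (hint hg'.locallyIntegrableOn)]
  linear_combination -e

/-! ### Test functions that are vertical derivatives -/

lemma notMem_compact_fiber {φ : Pt d → ℝ} (y : Base d) (t : ℝ)
    (ht : t ∉ Prod.snd '' tsupport φ) : φ (y, t) = 0 :=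
  image_eq_zero_of_notMem_tsupport fun h => ht ⟨_, h, rfl⟩

lemma hasCompactSupport_fiber {φ : Pt d → ℝ} (hc : HasCompactSupport φ) (y : Base d) :
    HasCompactSupport fun t => φ (y, t) :=
  HasCompactSupport.intro (IsCompact.image hc continuous_snd) fun t ht =>
    notMem_compact_fiber y t ht

lemma integrable_fiber {φ : Pt d → ℝ} (hφ : Continuous φ) (hc : HasCompactSupport φ)
    (y : Base d) : Integrable fun t => φ (y, t) :=
  (hφ.comp (by fun_prop : Continuous fun t : ℝ => ((y, t) : Pt d))).integrable_of_hasCompactSupport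
    (hasCompactSupport_fiber hc y)

/-- The integral is the convolution of the constant `1` with the reflected fibre, evaluated at `0`;
smoothness in the parameter comes from convolution. -/
lemma contDiff_vertical_integral {φ : Pt d → ℝ} (hφ : ContDiff ℝ ∞ φ)
    (hc : HasCompactSupport φ) : ContDiff ℝ ∞ fun y => ∫ s, φ (y, s) := by
  have h := contDiffOn_convolution_right_with_param_comp (𝕜 := ℝ) (μ := (volume : Measure ℝ))
    (n := ⊤) (ContinuousLinearMap.mul ℝ ℝ) (s := (univ : Set (Base d)))
    (v := fun _ => (0 : ℝ)) contDiffOn_const (f := fun _ => (1 : ℝ))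
    (g := fun y s => φ (y, -s)) (k := Neg.neg '' (Prod.snd '' tsupport φ)) isOpen_univ
    ((IsCompact.image hc continuous_snd).image continuous_neg)
    (fun y s _ hs => notMem_compact_fiber y (-s) fun h => hs ⟨-s, h, neg_neg s⟩)
    (locallyIntegrable_const 1)
    (hφ.comp (contDiff_fst.prodMk contDiff_snd.neg)).contDiffOn
  rw [contDiffOn_univ] at h
  convert h using 2 with y
  simp [convolution]

/-- The same device with the Heaviside function instead of the constant. -/
lemma contDiff_vertical_antideriv {φ : Pt d → ℝ} (hφ : ContDiff ℝ ∞ φ)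
    (hc : HasCompactSupport φ) : ContDiff ℝ ∞ fun x : Pt d => ∫ s in Iic x.2, φ (x.1, s) := by
  have h := contDiffOn_convolution_right_with_param (𝕜 := ℝ) (μ := (volume : Measure ℝ))
    (n := ⊤) (ContinuousLinearMap.mul ℝ ℝ) (s := (univ : Set (Base d)))
    (f := (Ici (0:ℝ)).indicator fun _ => (1 : ℝ))
    (g := fun y s => φ (y, s)) (k := Prod.snd '' tsupport φ) isOpen_univ
    (IsCompact.image hc continuous_snd)
    (fun y s _ hs => notMem_compact_fiber y s hs)
    ((locallyIntegrable_const 1).indicator measurableSet_Ici) hφ.contDiffOn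
  rw [univ_prod_univ, contDiffOn_univ] at h
  convert h using 2 with x
  rw [convolution_def, ← integral_indicator measurableSet_Iic,
    ← integral_sub_left_eq_self _ volume x.2]
  refine integral_congr_ae (Eventually.of_forall fun t => ?_)
  by_cases ht : 0 ≤ t <;> simp [indicator, ht]

lemma hasDerivAt_vertical_antideriv {φ : Pt d → ℝ} (hφ : Continuous φ)
    (hc : HasCompactSupport φ) (y : Base d) (t : ℝ) :
    HasDerivAt (fun t => ∫ s in Iic t, φ (y, s)) (φ (y, t)) t := by
  have hcy : Continuous fun t => φ (y, t) :=
    hφ.comp (by fun_prop : Continuous fun t : ℝ => ((y, t) : Pt d))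
  have hi := integrable_fiber hφ hc y
  have e : (fun t => ∫ s in Iic t, φ (y, s)) =
      fun t => (∫ s in Iic 0, φ (y, s)) + ∫ s in (0:ℝ)..t, φ (y, s) := by
    funext t
    rw [← intervalIntegral.integral_Iic_sub_Iic hi.integrableOn hi.integrableOn]
    ring
  rw [e]
  exact (intervalIntegral.integral_hasDerivAt_right (hcy.intervalIntegrable _ _)
    (hcy.stronglyMeasurableAtFilter _ _) hcy.continuousAt).const_add _

/-- The vertical hull of a set. -/
def verticalHull (K : Set (Pt d)) : Set (Pt d) :=
  {x | ∃ s₁ s₂, (x.1, s₁) ∈ K ∧ (x.1, s₂) ∈ K ∧ s₁ ≤ x.2 ∧ x.2 ≤ s₂}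

/-- The hull is the continuous image, under convex combination, of the compact set of pairs of
points of `K` over the same base point. -/
lemma isCompact_verticalHull {K : Set (Pt d)} (hK : IsCompact K) :
    IsCompact (verticalHull K) := by
  have hT : IsCompact ((K ×ˢ K ×ˢ Icc (0:ℝ) 1) ∩ {p | p.1.1 = p.2.1.1}) :=
    (hK.prod (hK.prod isCompact_Icc)).inter_right
      (isClosed_eq (by fun_prop) (by fun_prop))
  have e : verticalHull K = (fun p : Pt d × Pt d × ℝ =>
      ((p.1.1, (1 - p.2.2) * p.1.2 + p.2.2 * p.2.1.2) : Pt d)) ''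
      ((K ×ˢ K ×ˢ Icc (0:ℝ) 1) ∩ {p | p.1.1 = p.2.1.1}) := by
    ext ⟨y, t⟩
    constructor
    · rintro ⟨s₁, s₂, h1, h2, h3, h4⟩
      have ht : t ∈ segment ℝ s₁ s₂ := by
        rw [segment_eq_Icc (h3.trans h4)]; exact ⟨h3, h4⟩
      obtain ⟨a, b, ha, hb, hab, rfl⟩ := ht
      refine ⟨((y, s₁), (y, s₂), b), ⟨⟨h1, h2, hb, by linarith⟩, rfl⟩, ?_⟩
      have : a = 1 - b := by linarith
      simp [this]
    · rintro ⟨⟨⟨y₁, s₁⟩, ⟨y₂, s₂⟩, θ⟩, ⟨⟨h1, h2, hθ⟩, he⟩, heq⟩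
      simp only [mem_ofPred_eq, Prod.mk.injEq] at he heq h1 h2 hθ
      obtain ⟨rfl, rfl⟩ := heq
      subst he
      have hθ0 := hθ.1
      have hθ1 := hθ.2
      rcases le_total s₁ s₂ with h | h
      · exact ⟨s₁, s₂, h1, h2, by simp only; nlinarith, by simp only; nlinarith⟩
      · exact ⟨s₂, s₁, h2, h1, by simp only; nlinarith, by simp only; nlinarith⟩
  rw [e]
  exact hT.image (by fun_prop)

/-- A test function with vanishing vertical integrals is the vertical derivative of a test
function. -/
lemma exists_vertical_antideriv {φ : Pt d → ℝ} (hφ : ContDiff ℝ ∞ φ) {K : Set (Pt d)}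
    (hK : IsCompact K) (hφK : Function.support φ ⊆ K) (h0 : ∀ y, ∫ s, φ (y, s) = 0) :
    ∃ ψ : Pt d → ℝ, ContDiff ℝ ∞ ψ ∧ HasCompactSupport ψ ∧ tsupport ψ ⊆ verticalHull K ∧
      ∀ x, fderiv ℝ ψ x (dir none) = φ x := by
  have hc : HasCompactSupport φ := HasCompactSupport.of_support_subset_isCompact hK hφK
  have hψ := contDiff_vertical_antideriv hφ hc
  have hH := isCompact_verticalHull hK
  have hsub : Function.support (fun x : Pt d => ∫ s in Iic x.2, φ (x.1, s)) ⊆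
      verticalHull K := by
    rintro ⟨y, t⟩ hx
    have hx1 : ∫ s in Iic t, φ (y, s) ≠ 0 := hx
    have hi := integrable_fiber hφ.continuous hc y
    -- The total integral vanishes, so a nonzero integral below `t` forces one above `t`; `φ` is
    -- nonzero on both sides.
    have hx2 : ∫ s in Ioi t, φ (y, s) ≠ 0 := by
      have := intervalIntegral.integral_Iic_add_Ioi (b := t) hi.integrableOn hi.integrableOn
      rw [h0] at this
      intro h
      rw [h, add_zero] at this
      exact hx1 this
    obtain ⟨s₁, h1, h1'⟩ : ∃ s, s ≤ t ∧ φ (y, s) ≠ 0 := by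
      by_contra! h
      exact hx1 (setIntegral_eq_zero_of_forall_eq_zero fun s hs => h s hs)
    obtain ⟨s₂, h2, h2'⟩ : ∃ s, t < s ∧ φ (y, s) ≠ 0 := by
      by_contra! h
      exact hx2 (setIntegral_eq_zero_of_forall_eq_zero fun s hs => h s hs)
    exact ⟨s₁, s₂, hφK h1', hφK h2', h1, h2.le⟩
  refine ⟨_, hψ, HasCompactSupport.of_support_subset_isCompact hH hsub,
    closure_minimal hsub hH.isClosed, fun x => ?_⟩
  exact (deriv_vertical (hψ.differentiable (by simp)) x.1 x.2).unique
    (hasDerivAt_vertical_antideriv hφ.continuous hc x.1 x.2)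

/-! ### Existence of the trace -/

lemma BaseLocallyIntegrable.locallyIntegrableOn {E : Type*} [NormedAddCommGroup E]
    (hA : IsOpen A) (hf : Continuous f) {F : Pt d → E} (hF : BaseLocallyIntegrable A f F) :
    LocallyIntegrableOn F (region A f) := by
  rw [locallyIntegrableOn_iff (isOpen_region hA hf).isLocallyClosed]
  intro K hKs hK
  refine (hF (Prod.fst '' K) ?_ (hK.image continuous_fst)).mono_set fun x hx =>
    ⟨⟨x, hx, rfl⟩, (hKs hx).2⟩
  rintro _ ⟨x, hx, rfl⟩
  exact (hKs hx).1

lemma verticalHull_subset_region {K : Set (Pt d)} (hK : K ⊆ region A f) :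
    verticalHull K ⊆ region A f := by
  rintro x ⟨s₁, s₂, h1, h2, h3, h4⟩
  exact ⟨(hK h1).1, (hK h1).2.1.trans_le h3, h4.trans_lt (hK h2).2.2⟩

/-- Above the part of the base where `f > c`, the difference between `u` and the vertical primitive
of its weak vertical derivative does not depend on the height. -/
lemma exists_base_value (hA : IsOpen A) (hf : Continuous f) (hfpos : ∀ y ∈ A, 0 < f y)
    {u v : Pt d → ℂ} (hu : BaseLocallyIntegrable A f u)
    (hv : BaseLocallyIntegrable A f v) (hvm : StronglyMeasurable v)
    (hw : IsWeakPartial (region A f) none u v) {c : ℝ} (hc : 0 < c) :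
    ∃ h : Base d → ℂ, (∀ K ⊆ {y | y ∈ A ∧ c < f y}, IsCompact K → IntegrableOn h K) ∧
      ∀ᵐ y ∂volume.restrict {y | y ∈ A ∧ c < f y}, ∀ᵐ t ∂volume.restrict (Ioo 0 (f y)),
        u (y, t) - vprim v (y, t) = h y := by
  set Ac : Set (Base d) := {y | y ∈ A ∧ c < f y} with hAc
  have hAco : IsOpen Ac := hA.inter (isOpen_lt continuous_const hf)
  have hAcA : Ac ⊆ A := fun y hy => hy.1
  have hW := hv.vprim hf hvm
  -- One vertical profile supported in `[c/4, 3c/4]`, hence inside every fibre with `f > c`. This is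
  -- why the base is restricted to that set.
  let k : ContDiffBump (c / 2 : ℝ) := ⟨c / 8, c / 4, by positivity, by linarith⟩
  have hkc : ContDiff ℝ ∞ (k.normed volume) := k.contDiff_normed
  have hks : Function.support (k.normed volume) ⊆ Icc (c / 4) (3 * c / 4) := by
    rw [k.support_normed_eq, Real.ball_eq_Ioo]
    intro t ht
    have h1 : c / 2 - c / 4 < t := ht.1
    have h2 : t < c / 2 + c / 4 := ht.2
    constructor <;> linarith
  have hk1 : ∫ t, k.normed volume t = 1 := k.integral_normed
  obtain ⟨Ck, hCk⟩ := hkc.continuous.bounded_above_of_compact_support k.hasCompactSupport_normed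
  set w : Pt d → ℂ := fun x => u x - vprim v x with hwdef
  have hwi : BaseLocallyIntegrable A f w := fun K hK hKc => (hu K hK hKc).sub (hW K hK hKc)
  have hkw : ∀ K ⊆ A, IsCompact K →
      IntegrableOn (fun x : Pt d => k.normed volume x.2 • w x) (region K f) := fun K hK hKc =>
    integrableOn_smul_bounded (hwi K hK hKc) (hkc.continuous.comp continuous_snd)
      (fun x => hCk x.2)
  set h : Base d → ℂ := fun y => ∫ t in Ioo 0 (f y), k.normed volume t • w (y, t) with hh
  have hhi : ∀ K ⊆ A, IsCompact K → IntegrableOn h K := fun K hK hKc =>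
    integrableOn_integral_slice hKc.measurableSet hf (hkw K hK hKc)
  have hhf : BaseLocallyIntegrable A f fun x => h x.1 := fun K hK hKc =>
    integrableOn_comp_fst hKc hf (hhi K hK hKc)
  refine ⟨h, fun K hK => hhi K (hK.trans hAcA), ?_⟩
  have hae : ∀ᵐ x, x ∈ region Ac f → w x - h x.1 = 0 := by
    have hl : LocallyIntegrableOn (fun x => w x - h x.1) (region Ac f) :=
      BaseLocallyIntegrable.locallyIntegrableOn hAco hf fun K hK hKc =>
        (hwi K (hK.trans hAcA) hKc).sub (hhf K (hK.trans hAcA) hKc)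
    refine (isOpen_region hAco hf).ae_eq_zero_of_integral_contDiff_smul_eq_zero hl ?_
    intro φ hφ hφc hφs
    set K := shadow φ with hK
    have hKc : IsCompact K := isCompact_shadow hφc
    have hKAc : K ⊆ Ac := by rintro _ ⟨x, hx, rfl⟩; exact (hφs hx).1
    have hKA := hKAc.trans hAcA
    have hKm := hKc.measurableSet
    set Φ : Base d → ℝ := fun y => ∫ s, φ (y, s) with hΦ
    have hΦc : ContDiff ℝ ∞ Φ := contDiff_vertical_integral hφ hφc
    have hΦ0 : ∀ y ∉ K, Φ y = 0 := fun y hy => by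
      have : ∀ s, φ (y, s) = 0 := fun s => eq_zero_of_notMem_shadow (x := (y, s)) hy
      simp [hΦ, this]
    -- Removing the vertical mean of `φ` leaves zero vertical integrals without leaving the region.
    set φ₁ : Pt d → ℝ := fun x => φ x - Φ x.1 * k.normed volume x.2 with hφ₁
    have hφ₁c : ContDiff ℝ ∞ φ₁ :=
      hφ.sub ((hΦc.comp contDiff_fst).mul (hkc.comp contDiff_snd))
    set K₁ : Set (Pt d) := tsupport φ ∪ K ×ˢ Icc (c / 4) (3 * c / 4) with hK₁
    have hK₁c : IsCompact K₁ := IsCompact.union hφc (hKc.prod isCompact_Icc)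
    have hK₁s : K₁ ⊆ region A f := by
      rintro x (hx | hx)
      · exact region_mono hAcA (hφs hx)
      · have h1 := (hKAc hx.1).2
        exact ⟨hKA hx.1, by linarith [hx.2.1], by linarith [hx.2.2]⟩
    have hsupp : Function.support φ₁ ⊆ K₁ := by
      intro x hx
      by_contra hn
      rw [hK₁, mem_union, not_or] at hn
      apply hx
      simp only [hφ₁]
      rw [image_eq_zero_of_notMem_tsupport hn.1, zero_sub, neg_eq_zero, mul_eq_zero]
      by_cases hxK : x.1 ∈ K
      · right
        by_contra hk
        exact hn.2 ⟨hxK, hks hk⟩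
      · exact Or.inl (hΦ0 _ hxK)
    have hzero : ∀ y, ∫ s, φ₁ (y, s) = 0 := fun y => by
      simp only [hφ₁]
      rw [integral_sub (integrable_fiber hφ.continuous hφc y)
        ((hkc.continuous.integrable_of_hasCompactSupport k.hasCompactSupport_normed).const_mul _),
        integral_const_mul, hk1, mul_one, sub_self]
    obtain ⟨ψ, hψ, hψc, hψs, hψd⟩ := exists_vertical_antideriv hφ₁c hK₁c hsupp hzero
    have hψr : tsupport ψ ⊆ region A f := hψs.trans (verticalHull_subset_region hK₁s)
    have e1 := hw ψ hψ hψc hψr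
    -- `vprim v` has the same weak vertical derivative as `u` and initial value `0`, so `u - vprim
    -- v` is orthogonal to `φ₁`.
    have e2 := green_of_representation hA hf hfpos hW hv (g := fun _ => 0)
      (locallyIntegrableOn_const 0)
      (Eventually.of_forall fun y => by
        filter_upwards [ae_restrict_mem measurableSet_Ioo] with t ht
        rw [vprim_eq v y ht.1.le, zero_add]) hψ hψc (hψr.trans fun x hx => ⟨hx.1, hx.2.2⟩)
    simp only [smul_zero, integral_zero, sub_zero, hψd] at e1 e2
    have hv0 : ∀ x : Pt d, x.1 ∉ K → φ₁ x = 0 := fun x hx => by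
      simp only [hφ₁]
      rw [eq_zero_of_notMem_shadow hx, hΦ0 _ hx, zero_mul, sub_zero]
    rw [setIntegral_region_eq_shadow hA hf hKA fun x hx => by rw [hv0 x hx, zero_smul]] at e1 e2
    obtain ⟨C, hC⟩ := exists_norm_le_of_hasCompactSupport hφ.continuous hφc
    obtain ⟨C₁, hC₁⟩ := exists_norm_le_of_hasCompactSupport hφ₁c.continuous
      (HasCompactSupport.of_support_subset_isCompact hK₁c hsupp)
    have hΦcs : HasCompactSupport Φ := HasCompactSupport.intro hKc hΦ0
    obtain ⟨C₂, hC₂⟩ := hΦc.continuous.bounded_above_of_compact_support hΦcs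
    have e3 : ∫ x in region K f, φ₁ x • w x = 0 := by
      simp only [hwdef, smul_sub]
      rw [integral_sub (integrableOn_smul_bounded (hu K hKA hKc) hφ₁c.continuous hC₁)
        (integrableOn_smul_bounded (hW K hKA hKc) hφ₁c.continuous hC₁), e1, e2, sub_self]
    have hi1 := integrableOn_smul_bounded (hwi K hKA hKc) hφ.continuous hC
    have hi2 := integrableOn_smul_bounded (hkw K hKA hKc) (hΦc.continuous.comp continuous_fst)
      (fun x => hC₂ x.1)
    have hi3 := integrableOn_smul_bounded (hhf K hKA hKc) hφ.continuous hC
    simp only [Function.comp_apply] at hi2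
    have e4 : ∫ x in region K f, φ x • w x =
        ∫ x in region K f, Φ x.1 • k.normed volume x.2 • w x := by
      rw [← sub_eq_zero, ← integral_sub hi1 hi2, ← e3]
      simp only [hφ₁, sub_smul, mul_smul]
    -- By Fubini both sides equal `∫ Φ(y) h(y) dy`: on the left the profile is integrated out into
    -- `h`, on the right `φ` into `Φ`.
    have e5 : ∫ x in region K f, Φ x.1 • k.normed volume x.2 • w x =
        ∫ x in region K f, φ x • h x.1 := by
      rw [integral_region hKm hf hi2, integral_region hKm hf hi3]
      refine setIntegral_congr_fun hKm fun y hy => ?_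
      simp only
      rw [integral_smul, integral_smul_const]
      congr 1
      refine (setIntegral_eq_integral_of_forall_compl_eq_zero fun t ht => ?_).symm
      exact image_eq_zero_of_notMem_tsupport fun hx => ht (hφs hx).2
    rw [← setIntegral_eq_integral_of_forall_compl_eq_zero (s := region K f) fun x hx => by
      rw [image_eq_zero_of_notMem_tsupport fun hxs => hx ⟨⟨x, hxs, rfl⟩, (hφs hxs).2⟩, zero_smul]]
    simp only [smul_sub]
    rw [integral_sub hi1 hi3, e4, e5, sub_self]
  have hr := (ae_restrict_iff' (measurableSet_region hAco.measurableSet hf)).2 hae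
  filter_upwards [ae_slice hAco.measurableSet hf hr] with y hy
  filter_upwards [hy] with t ht using sub_eq_zero.1 ht

/-- The value found above `{f > c}` depends a priori on `c`. The fibre average of `u - vprim v` is
one formula that agrees with all of them, and the sets `{f > 1/(n+1)}` exhaust `A`. -/
lemma exists_trace_of_stronglyMeasurable (hA : IsOpen A) (hf : Continuous f)
    (hfpos : ∀ y ∈ A, 0 < f y) {u v : Pt d → ℂ} (hu : BaseLocallyIntegrable A f u)
    (hv : BaseLocallyIntegrable A f v) (hvm : StronglyMeasurable v)
    (hw : IsWeakPartial (region A f) none u v) :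
    ∃ g : Base d → ℂ, LocallyIntegrableOn g A ∧
      ∀ᵐ y ∂volume.restrict A, ∀ᵐ t ∂volume.restrict (Ioo 0 (f y)),
        u (y, t) = g y + ∫ s in (0:ℝ)..t, v (y, s) := by
  set g : Base d → ℂ := fun y => (f y)⁻¹ • ∫ t in Ioo 0 (f y), (u (y, t) - vprim v (y, t)) with hg
  have key : ∀ c, 0 < c → ∃ h : Base d → ℂ,
      (∀ K ⊆ {y | y ∈ A ∧ c < f y}, IsCompact K → IntegrableOn h K) ∧
      ∀ᵐ y ∂volume.restrict {y | y ∈ A ∧ c < f y}, h y = g y ∧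
        ∀ᵐ t ∂volume.restrict (Ioo 0 (f y)), u (y, t) - vprim v (y, t) = g y := by
    intro c hc
    obtain ⟨h, h1, h2⟩ := exists_base_value hA hf hfpos hu hv hvm hw hc
    refine ⟨h, h1, ?_⟩
    filter_upwards [h2, ae_restrict_mem (hA.inter (isOpen_lt continuous_const hf)).measurableSet]
      with y hy hyc
    have hb : 0 < f y := hfpos y hyc.1
    have e : g y = h y := by
      simp only [hg]
      rw [integral_congr_ae hy, setIntegral_const, Real.volume_real_Ioo_of_le hb.le, sub_zero,
        smul_smul, inv_mul_cancel₀ hb.ne', one_smul]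
    exact ⟨e.symm, by rw [e]; exact hy⟩
  refine ⟨g, ?_, ?_⟩
  · intro y hy
    have hb := hfpos y hy
    obtain ⟨h, h1, h2⟩ := key (f y / 2) (by positivity)
    have hO : IsOpen {z | z ∈ A ∧ f y / 2 < f z} := hA.inter (isOpen_lt continuous_const hf)
    obtain ⟨K, hKc, hyK, hKs⟩ := exists_compact_subset hO
      (show y ∈ {z | z ∈ A ∧ f y / 2 < f z} from ⟨hy, by linarith⟩)
    refine ⟨K, mem_nhdsWithin_of_mem_nhds (mem_interior_iff_mem_nhds.1 hyK), ?_⟩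
    refine (h1 K hKs hKc).congr ?_
    filter_upwards [ae_restrict_of_ae_restrict_of_subset hKs h2] with z hz using hz.1
  · have hU : A ⊆ ⋃ n : ℕ, {y | y ∈ A ∧ 1 / ((n : ℝ) + 1) < f y} := fun y hy => by
      obtain ⟨n, hn⟩ := exists_nat_one_div_lt (hfpos y hy)
      exact mem_iUnion.2 ⟨n, hy, hn⟩
    refine ae_restrict_of_ae_restrict_of_subset hU ?_
    rw [ae_restrict_iUnion_iff]
    intro n
    obtain ⟨h, -, h2⟩ := key (1 / ((n : ℝ) + 1)) (by positivity)
    filter_upwards [h2] with y hy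
    filter_upwards [hy.2, ae_restrict_mem measurableSet_Ioo] with t ht htI
    rw [← vprim_eq v y htI.1.le, ← ht]
    ring

/-- A function in `H¹` has a trace on the base, and is fibrewise the primitive of its weak vertical
derivative with the trace as initial value. -/
theorem IsH1.exists_trace (hA : IsOpen A) (hf : Continuous f) (hfpos : ∀ y ∈ A, 0 < f y)
    {u : Pt d → ℂ} {G : Option (Fin d) → Pt d → ℂ} (h : IsH1 (region A f) u G) :
    ∃ g, IsBaseTrace A f u (G none) g ∧
      ∀ᵐ y ∂volume.restrict A, ∀ᵐ t ∂volume.restrict (Ioo 0 (f y)),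
        u (y, t) = g y + ∫ s in (0:ℝ)..t, G none (y, s) := by
  have hu : BaseLocallyIntegrable A f u := .of_memLp hf h.memLp
  have hv : BaseLocallyIntegrable A f (G none) := .of_memLp hf (h.memLp_grad none)
  have hm := (h.memLp_grad none).1
  set v := hm.mk (G none) with hvdef
  have hae : G none =ᵐ[volume.restrict (region A f)] v := hm.ae_eq_mk
  have hvm : StronglyMeasurable v := hm.stronglyMeasurable_mk
  have hv' : BaseLocallyIntegrable A f v := fun K hK hKc =>
    (hv K hK hKc).congr (ae_restrict_of_ae_restrict_of_subset (region_mono hK) hae)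
  have hw : IsWeakPartial (region A f) none u v := fun φ h1 h2 h3 => by
    rw [h.weak none φ h1 h2 h3]
    congr 1
    refine integral_congr_ae ?_
    filter_upwards [hae] with x hx
    rw [hx]
  obtain ⟨g, hg, hrep⟩ := exists_trace_of_stronglyMeasurable hA hf hfpos hu hv' hvm hw
  have hrep' : ∀ᵐ y ∂volume.restrict A, ∀ᵐ t ∂volume.restrict (Ioo 0 (f y)),
      u (y, t) = g y + ∫ s in (0:ℝ)..t, G none (y, s) := by
    filter_upwards [hrep, ae_slice hA.measurableSet hf hae] with y hy hvy
    filter_upwards [hy, ae_restrict_mem measurableSet_Ioo] with t ht htI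
    rw [ht]
    congr 1
    rw [intervalIntegral.integral_of_le htI.1.le, intervalIntegral.integral_of_le htI.1.le]
    refine integral_congr_ae ?_
    have hsub : Ioc 0 t ⊆ Ioo 0 (f y) := fun s hs => ⟨hs.1, hs.2.trans_lt htI.2⟩
    filter_upwards [ae_restrict_of_ae_restrict_of_subset hsub hvy] with s hs using hs.symm
  exact ⟨g, ⟨hg, fun φ h1 h2 h3 => green_of_representation hA hf hfpos hu hv hg hrep' h1 h2 h3⟩,
    hrep'⟩

/-! ### Measurability of the weight and passage to positive and negative parts -/

lemma measurable_neg_mu {σ : Base d → ℝ} (hf : Continuous f) (hσ : Measurable σ) :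
    Measurable ({y | 0 < f y ∧ σ y < 0}.indicator fun y => -mu (f y) (σ y)) := by
  have hB : MeasurableSet {y | 0 < f y ∧ σ y < 0} :=
    (measurableSet_lt measurable_const hf.measurable).inter
      (measurableSet_lt hσ measurable_const)
  refine measurable_of_Iio fun a => ?_
  by_cases ha : 0 < a
  · have e : ({y | 0 < f y ∧ σ y < 0}.indicator fun y => -mu (f y) (σ y)) ⁻¹' Iio a =
        {y | 0 < f y ∧ σ y < 0}ᶜ ∪ ({y | 0 < f y ∧ σ y < 0} ∩ {y | -σ y < sqrtTanh (f y) a}) := by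
      ext y
      by_cases hy : y ∈ {y | 0 < f y ∧ σ y < 0}
      · rw [mem_preimage, indicator_of_mem hy, mem_Iio, neg_mu_lt_iff hy.1 hy.2]
        simp only [mem_union, mem_compl_iff, hy, mem_inter_iff, ha]
        simp
      · rw [mem_preimage, indicator_of_notMem hy]
        simp only [mem_union, mem_compl_iff, hy, mem_inter_iff, mem_Iio, ha]
        simp
    rw [e]
    have hc : Continuous fun y => sqrtTanh (f y) a :=
      continuous_const.mul (continuous_tanh.comp (hf.mul continuous_const))
    exact hB.compl.union (hB.inter (measurableSet_lt hσ.neg hc.measurable))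
  · have e : ({y | 0 < f y ∧ σ y < 0}.indicator fun y => -mu (f y) (σ y)) ⁻¹' Iio a = ∅ := by
      ext y
      simp only [mem_preimage, mem_Iio, mem_empty_iff_false, iff_false, not_lt]
      refine (not_lt.1 ha).trans (indicator_nonneg (fun z hz => ?_) y)
      exact (neg_mu_spec hz.1 hz.2).1.le
    rw [e]
    exact MeasurableSet.empty

/-- The weight as a function on the base. -/
noncomputable def baseWeight (A : Set (Base d)) (f σ : Base d → ℝ) (y : Base d) : ℝ :=
  (baseSetPos A σ).indicator (fun y => 1 / 2 * ((f y + 1 / (2 * σ y)) ^ 2)⁻¹) y +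
    (baseSetNeg A σ).indicator (fun y => mu (f y) (σ y)) y

lemma aemeasurable_baseWeight (hA : IsOpen A) (hf : Continuous f) (hfpos : ∀ y ∈ A, 0 < f y)
    {σ : Base d → ℝ} (hσ : AEMeasurable σ (volume.restrict A)) :
    AEMeasurable (baseWeight A f σ) (volume.restrict A) := by
  set τ := hσ.mk σ with hτ
  have hτm : Measurable τ := hσ.measurable_mk
  have hm : Measurable fun y =>
      {y | 0 < τ y}.indicator (fun y => 1 / 2 * ((f y + 1 / (2 * τ y)) ^ 2)⁻¹) y -
        {y | 0 < f y ∧ τ y < 0}.indicator (fun y => -mu (f y) (τ y)) y := by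
    refine Measurable.sub (Measurable.indicator ?_ (measurableSet_lt measurable_const hτm))
      (measurable_neg_mu hf hτm)
    have := hf.measurable
    fun_prop
  refine ⟨_, hm, ?_⟩
  filter_upwards [hσ.ae_eq_mk, ae_restrict_mem hA.measurableSet] with y hy hyA
  have hb := hfpos y hyA
  rw [← hτ] at hy
  rcases lt_trichotomy (σ y) 0 with h | h | h
  · have h1 : y ∉ baseSetPos A σ := fun h' => lt_asymm h h'.2
    have h2 : y ∈ baseSetNeg A σ := ⟨hyA, h⟩
    have h3 : y ∉ {y | 0 < τ y} := fun h' => lt_asymm (hy ▸ h) h'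
    have h4 : y ∈ {y | 0 < f y ∧ τ y < 0} := ⟨hb, hy ▸ h⟩
    rw [baseWeight, indicator_of_notMem h1, indicator_of_mem h2, indicator_of_notMem h3,
      indicator_of_mem h4, hy]
    ring
  · have h1 : y ∉ baseSetPos A σ := fun h' => h'.2.ne' h
    have h2 : y ∉ baseSetNeg A σ := fun h' => h'.2.ne h
    have h3 : y ∉ {y | 0 < τ y} := fun h' => (ne_of_gt (show 0 < τ y from h')) (hy ▸ h)
    have h4 : y ∉ {y | 0 < f y ∧ τ y < 0} := fun h' => h'.2.ne (hy ▸ h)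
    rw [baseWeight, indicator_of_notMem h1, indicator_of_notMem h2, indicator_of_notMem h3,
      indicator_of_notMem h4]
    ring
  · have h1 : y ∈ baseSetPos A σ := ⟨hyA, h⟩
    have h2 : y ∉ baseSetNeg A σ := fun h' => lt_asymm h h'.2
    have h3 : y ∈ {y | 0 < τ y} := show 0 < τ y from hy ▸ h
    have h4 : y ∉ {y | 0 < f y ∧ τ y < 0} := fun h' => lt_asymm (hy ▸ h) h'.2
    rw [baseWeight, indicator_of_mem h1, indicator_of_notMem h2, indicator_of_mem h3,
      indicator_of_notMem h4, hy]
    ring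

lemma aemeasurable_comp_fst {r : Base d → ℝ}
    (hr : AEMeasurable r (volume.restrict A)) :
    AEMeasurable (fun x : Pt d => r x.1) (volume.restrict (region A f)) := by
  have h1 : AEMeasurable (fun x : Pt d => r x.1)
      ((volume.restrict A).prod (volume : Measure ℝ)) :=
    hr.comp_quasiMeasurePreserving Measure.quasiMeasurePreserving_fst
  refine h1.mono_measure ?_
  rw [Measure.restrict_prod_eq_prod_univ, ← Measure.volume_eq_prod]
  exact Measure.restrict_mono (show region A f ⊆ A ×ˢ univ from fun x hx => ⟨hx.1, trivial⟩) le_rfl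

lemma aemeasurable_lintegral_slice (hS : MeasurableSet S) (hf : Continuous f)
    {F : Pt d → ENNReal} (hF : AEMeasurable F (volume.restrict (region S f))) :
    AEMeasurable (fun y => ∫⁻ t in Ioo 0 (f y), F (y, t)) (volume.restrict S) := by
  have hm := measurableSet_region hS hf
  have h : AEMeasurable ((region S f).indicator F) ((volume : Measure (Base d)).prod volume) :=
    (aemeasurable_indicator_iff hm).2 hF
  rw [← aemeasurable_indicator_iff hS]
  refine h.lintegral_prod_right'.congr (Eventually.of_forall fun y => ?_)
  simp only
  rw [indicator_region]
  by_cases hy : y ∈ S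
  · simp only [indicator_of_mem hy]
    rw [lintegral_indicator measurableSet_Ioo]
  · simp only [indicator_of_notMem hy]
    exact lintegral_zero

lemma lintegral_ofReal_const_mul {α : Type*} [MeasurableSpace α] {μ : Measure α} {F : α → ℝ}
    (r : ℝ) (hF : Integrable F μ) (h0 : ∀ x, 0 ≤ F x) :
    ∫⁻ x, ENNReal.ofReal (r * F x) ∂μ = ENNReal.ofReal (r * ∫ x, F x ∂μ) := by
  have e : ∀ x, ENNReal.ofReal (r * F x) = ENNReal.ofReal r * ENNReal.ofReal (F x) :=
    fun x => ENNReal.ofReal_mul' (h0 x)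
  simp only [e]
  rw [lintegral_const_mul' _ _ ENNReal.ofReal_ne_top, ENNReal.ofReal_mul' (integral_nonneg h0),
    ofReal_integral_eq_lintegral_ofReal hF (Eventually.of_forall h0)]

/-- Write `z = z⁺ - z⁻` for `a` and `x` and rearrange. Done fibrewise, before integrating, this
never produces `∞ - ∞`. -/
lemma ofReal_move_negative_parts {a p x G : ℝ} (hp : 0 ≤ p) (hG : 0 ≤ G) (h : a + p ≤ G + x) :
    ENNReal.ofReal a + ENNReal.ofReal p + ENNReal.ofReal (-x) ≤
      ENNReal.ofReal G + ENNReal.ofReal x + ENNReal.ofReal (-a) := by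
  have e : ∀ z : ℝ, ENNReal.ofReal z = ENNReal.ofReal (max z 0) := fun z => by simp
  rw [e a, e x, e (-x), e (-a), ← ENNReal.ofReal_add (le_max_right _ _) hp,
    ← ENNReal.ofReal_add (by positivity) (le_max_right _ _),
    ← ENNReal.ofReal_add hG (le_max_right _ _),
    ← ENNReal.ofReal_add (by positivity) (le_max_right _ _)]
  refine ENNReal.ofReal_le_ofReal ?_
  have h1 := max_zero_sub_max_neg_zero_eq_self a
  have h2 := max_zero_sub_max_neg_zero_eq_self x
  linarith

lemma integrable_of_lintegral_ofReal_lt_top {α : Type*} [MeasurableSpace α] {μ : Measure α}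
    {F : α → ℝ} (hF : AEMeasurable F μ) (h1 : ∫⁻ x, ENNReal.ofReal (F x) ∂μ < ⊤)
    (h2 : ∫⁻ x, ENNReal.ofReal (-F x) ∂μ < ⊤) : Integrable F μ := by
  refine ⟨hF.aestronglyMeasurable, ?_⟩
  refine lt_of_le_of_lt ?_ (ENNReal.add_lt_top.2 ⟨h1, h2⟩)
  rw [← lintegral_add_left' hF.ennreal_ofReal]
  refine lintegral_mono fun x => ?_
  rw [← ofReal_norm, Real.norm_eq_abs]
  rcases le_total 0 (F x) with h | h
  · rw [abs_of_nonneg h]; exact le_self_add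
  · rw [abs_of_nonpos h]; exact le_add_self

lemma nullMeasurableSet_baseSetPos (hA : IsOpen A) {σ : Base d → ℝ}
    (hσ : AEMeasurable σ (volume.restrict A)) :
    NullMeasurableSet (baseSetPos A σ) (volume.restrict A) :=
  hA.measurableSet.nullMeasurableSet.inter (nullMeasurableSet_lt aemeasurable_const hσ)

lemma restrict_baseSetPos (hA : IsOpen A) {σ : Base d → ℝ}
    (hσ : AEMeasurable σ (volume.restrict A)) :
    (volume.restrict A).restrict (baseSetPos A σ) = volume.restrict (baseSetPos A σ) := by
  rw [Measure.restrict_restrict₀ (nullMeasurableSet_baseSetPos hA hσ),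
    inter_eq_left.2 fun y hy => hy.1]

/-! ### Fibre inequalities and integration over the base -/

/-- The density of the boundary term gained on `A₊`. -/
noncomputable def baseGain (A : Set (Base d)) (f σ : Base d → ℝ) (g : Base d → ℂ) (y : Base d) : ℝ :=
  (baseSetPos A σ).indicator (fun y => 1 / 2 * ((f y + 1 / (2 * σ y))⁻¹ * ‖g y‖ ^ 2)) y

lemma baseGain_nonneg (hfpos : ∀ y ∈ A, 0 < f y) (σ : Base d → ℝ) (g : Base d → ℂ)
    (y : Base d) : 0 ≤ baseGain A f σ g y := by
  refine indicator_nonneg (fun y hy => ?_) y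
  have h1 := hfpos y hy.1
  have h2 := hy.2
  positivity

lemma baseWeight_fiber_ineq (hfpos : ∀ y ∈ A, 0 < f y) (σ : Base d → ℝ) (g : Base d → ℂ)
    {y : Base d} (hy : y ∈ A) {v : ℝ → ℂ} (hv : IntervalIntegrable v volume 0 (f y))
    (hv2 : IntervalIntegrable (fun t => ‖v t‖ ^ 2) volume 0 (f y)) :
    baseWeight A f σ y * (∫ t in (0:ℝ)..f y, ‖g y + ∫ s in (0:ℝ)..t, v s‖ ^ 2) +
        baseGain A f σ g y ≤ (∫ t in (0:ℝ)..f y, ‖v t‖ ^ 2) + σ y * ‖g y‖ ^ 2 := by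
  have hb := hfpos y hy
  rcases lt_trichotomy (σ y) 0 with h | h | h
  · have h1 : y ∉ baseSetPos A σ := fun h' => lt_asymm h h'.2
    have h2 : y ∈ baseSetNeg A σ := ⟨hy, h⟩
    rw [baseWeight, baseGain, indicator_of_notMem h1, indicator_of_notMem h1, indicator_of_mem h2]
    obtain ⟨h3, h4, -⟩ := neg_mu_spec hb h
    have h5 := fiber_ineq_neg (c := g y) hb h3 hv hv2
    rw [sqrtTanh] at h4
    rw [h4] at h5
    linarith
  · have h1 : y ∉ baseSetPos A σ := fun h' => h'.2.ne' h
    have h2 : y ∉ baseSetNeg A σ := fun h' => h'.2.ne h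
    rw [baseWeight, baseGain, indicator_of_notMem h1, indicator_of_notMem h1,
      indicator_of_notMem h2, h]
    have : 0 ≤ ∫ t in (0:ℝ)..f y, ‖v t‖ ^ 2 :=
      intervalIntegral.integral_nonneg hb.le fun t _ => sq_nonneg _
    linarith
  · have h1 : y ∈ baseSetPos A σ := ⟨hy, h⟩
    have h2 : y ∉ baseSetNeg A σ := fun h' => lt_asymm h h'.2
    rw [baseWeight, baseGain, indicator_of_mem h1, indicator_of_mem h1, indicator_of_notMem h2,
      add_zero]
    exact fiber_ineq_pos hb h hv hv2

/-- Only `σ < 0` needs an argument, since elsewhere the weight is nonnegative. The bound makes the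
negative part of `ρ|u|²` integrable. -/
lemma neg_baseWeight_fiber_le (hfpos : ∀ y ∈ A, 0 < f y) (σ : Base d → ℝ) (c : ℂ)
    {y : Base d} (hy : y ∈ A) {v : ℝ → ℂ} (hv : IntervalIntegrable v volume 0 (f y))
    (hv2 : IntervalIntegrable (fun t => ‖v t‖ ^ 2) volume 0 (f y)) :
    -baseWeight A f σ y * (∫ t in (0:ℝ)..f y, ‖c + ∫ s in (0:ℝ)..t, v s‖ ^ 2) ≤
      8 * (∫ t in (0:ℝ)..f y, ‖v t‖ ^ 2) + 8 * |σ y * ‖c‖ ^ 2| +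
        4 * σ y ^ 2 * ∫ t in (0:ℝ)..f y, ‖c + ∫ s in (0:ℝ)..t, v s‖ ^ 2 := by
  have hb := hfpos y hy
  have hV : 0 ≤ ∫ t in (0:ℝ)..f y, ‖v t‖ ^ 2 :=
    intervalIntegral.integral_nonneg hb.le fun t _ => sq_nonneg _
  have hU : 0 ≤ ∫ t in (0:ℝ)..f y, ‖c + ∫ s in (0:ℝ)..t, v s‖ ^ 2 :=
    intervalIntegral.integral_nonneg hb.le fun t _ => sq_nonneg _
  rcases lt_or_ge (σ y) 0 with h | h
  · have h1 : y ∉ baseSetPos A σ := fun h' => lt_asymm h h'.2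
    have h2 : y ∈ baseSetNeg A σ := ⟨hy, h⟩
    rw [baseWeight, indicator_of_notMem h1, indicator_of_mem h2, zero_add]
    refine (neg_mu_mul_le hb h hv hv2).trans ?_
    have := neg_abs_le (σ y * ‖c‖ ^ 2)
    linarith
  · have h2 : y ∉ baseSetNeg A σ := fun h' => not_lt.2 h h'.2
    have h3 : 0 ≤ baseWeight A f σ y := by
      rw [baseWeight, indicator_of_notMem h2, add_zero]
      exact indicator_nonneg (fun z _ => by positivity) y
    have h4 := mul_nonneg h3 hU
    have h5 : 0 ≤ 8 * |σ y * ‖c‖ ^ 2| := by positivity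
    have h6 : 0 ≤ 4 * σ y ^ 2 * ∫ t in (0:ℝ)..f y, ‖c + ∫ s in (0:ℝ)..t, v s‖ ^ 2 := by
      positivity
    linarith

lemma gradSq_nonneg (G : Option (Fin d) → Pt d → ℂ) (x : Pt d) : 0 ≤ gradSq G x :=
  Finset.sum_nonneg fun _ _ => sq_nonneg _

lemma sq_norm_le_gradSq (G : Option (Fin d) → Pt d → ℂ) (j : Option (Fin d)) (x : Pt d) :
    ‖G j x‖ ^ 2 ≤ gradSq G x :=
  Finset.single_le_sum (f := fun j => ‖G j x‖ ^ 2) (fun _ _ => sq_nonneg _) (Finset.mem_univ j)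

lemma integrableOn_sq_norm {α : Type*} [MeasurableSpace α] {μ : Measure α} {s : Set α} {u : α → ℂ}
    (hu : MemLp u 2 (μ.restrict s)) : IntegrableOn (fun x => ‖u x‖ ^ 2) s μ :=
  (memLp_two_iff_integrable_sq_norm hu.1).1 hu

lemma IsH1.integrableOn_gradSq {u : Pt d → ℂ} {G : Option (Fin d) → Pt d → ℂ}
    (h : IsH1 (region A f) u G) : IntegrableOn (gradSq G) (region A f) :=
  integrable_finsetSum _ fun j _ => integrableOn_sq_norm (h.memLp_grad j)

/-- The inequalities on almost every vertical fibre. -/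
lemma IsH1.ae_fiber_ineq (hA : IsOpen A) (hf : Continuous f) (hfpos : ∀ y ∈ A, 0 < f y)
    {u : Pt d → ℂ} {G : Option (Fin d) → Pt d → ℂ} (h : IsH1 (region A f) u G)
    {g : Base d → ℂ} (hg : IsBaseTrace A f u (G none) g) (σ : Base d → ℝ) :
    ∀ᵐ y ∂volume.restrict A,
      IntegrableOn (fun t => ‖u (y, t)‖ ^ 2) (Ioo 0 (f y)) ∧
      IntegrableOn (fun t => gradSq G (y, t)) (Ioo 0 (f y)) ∧
      baseWeight A f σ y * (∫ t in Ioo 0 (f y), ‖u (y, t)‖ ^ 2) + baseGain A f σ g y ≤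
        (∫ t in Ioo 0 (f y), gradSq G (y, t)) + σ y * ‖g y‖ ^ 2 ∧
      -baseWeight A f σ y * (∫ t in Ioo 0 (f y), ‖u (y, t)‖ ^ 2) ≤
        8 * (∫ t in Ioo 0 (f y), gradSq G (y, t)) + 8 * |σ y * ‖g y‖ ^ 2| +
          4 * σ y ^ 2 * ∫ t in Ioo 0 (f y), ‖u (y, t)‖ ^ 2 := by
  obtain ⟨g₀, hg₀, hrep⟩ := h.exists_trace hA hf hfpos
  have hAm := hA.measurableSet
  have hvm : ∀ᵐ y ∂volume.restrict A,
      AEStronglyMeasurable (fun t => G none (y, t)) (volume.restrict (Ioo 0 (f y))) := by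
    have hm := (h.memLp_grad none).1
    filter_upwards [ae_slice hAm hf hm.ae_eq_mk] with y hy
    exact ⟨_, hm.stronglyMeasurable_mk.comp_measurable (by fun_prop), hy⟩
  -- Uniqueness transfers the fibrewise representation from the constructed trace to the given one.
  filter_upwards [hg.ae_eq hA hf hfpos hg₀, hrep, hvm,
    integrableOn_slice hAm hf (integrableOn_sq_norm h.memLp),
    integrableOn_slice hAm hf (integrableOn_sq_norm (h.memLp_grad none)),
    integrableOn_slice hAm hf h.integrableOn_gradSq, ae_restrict_mem hAm]
    with y hgy hry hvy hu2 hv2 hG2 hyA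
  have hb := hfpos y hyA
  have : IsFiniteMeasure ((volume : Measure ℝ).restrict (Ioo 0 (f y))) := ⟨by simp⟩
  have hv1 : IntegrableOn (fun t => G none (y, t)) (Ioo 0 (f y)) :=
    ((memLp_two_iff_integrable_sq_norm hvy).2 hv2).integrable (by norm_num)
  have hI : IntervalIntegrable (fun t => G none (y, t)) volume 0 (f y) :=
    (intervalIntegrable_iff_integrableOn_Ioo_of_le hb.le).2 hv1
  have hI2 : IntervalIntegrable (fun t => ‖G none (y, t)‖ ^ 2) volume 0 (f y) :=
    (intervalIntegrable_iff_integrableOn_Ioo_of_le hb.le).2 hv2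
  have h1 := baseWeight_fiber_ineq hfpos σ g hyA hI hI2
  have h2 := neg_baseWeight_fiber_le hfpos σ (g y) hyA hI hI2
  have e : ∫ t in (0:ℝ)..f y, ‖g y + ∫ s in (0:ℝ)..t, G none (y, s)‖ ^ 2 =
      ∫ t in Ioo 0 (f y), ‖u (y, t)‖ ^ 2 := by
    rw [intervalIntegral.integral_of_le hb.le, integral_Ioc_eq_integral_Ioo]
    refine integral_congr_ae ?_
    filter_upwards [hry] with t ht
    rw [ht, hgy]
  -- The horizontal derivatives are discarded here.
  have e2 : ∫ t in (0:ℝ)..f y, ‖G none (y, t)‖ ^ 2 ≤ ∫ t in Ioo 0 (f y), gradSq G (y, t) := by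
    rw [intervalIntegral.integral_of_le hb.le, integral_Ioc_eq_integral_Ioo]
    exact integral_mono hv2 hG2 fun t => sq_norm_le_gradSq G none (y, t)
  rw [e] at h1 h2
  exact ⟨hu2, hG2, by linarith, by linarith⟩

lemma rho_eq_baseWeight (A : Set (Base d)) (f σ : Base d → ℝ) (x : Pt d) :
    rho A f σ x = baseWeight A f σ x.1 := rfl

lemma aemeasurable_rho_mul (hA : IsOpen A) (hf : Continuous f) (hfpos : ∀ y ∈ A, 0 < f y)
    {σ : Base d → ℝ} (hσ : AEMeasurable σ (volume.restrict A)) {u : Pt d → ℂ}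
    (hu : AEStronglyMeasurable u (volume.restrict (region A f))) :
    AEMeasurable (fun x => rho A f σ x * ‖u x‖ ^ 2) (volume.restrict (region A f)) :=
  (aemeasurable_comp_fst (aemeasurable_baseWeight hA hf hfpos hσ)).mul
    (hu.norm.aemeasurable.pow_const 2)

lemma IsBaseTrace.aemeasurable_sq {u v : Pt d → ℂ} {g : Base d → ℂ}
    (hg : IsBaseTrace A f u v g) {σ : Base d → ℝ} (hσ : AEMeasurable σ (volume.restrict A)) :
    AEMeasurable (fun y => σ y * ‖g y‖ ^ 2) (volume.restrict A) :=
  hσ.mul (hg.locallyIntegrableOn.aestronglyMeasurable.norm.aemeasurable.pow_const 2)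

lemma IsBaseTrace.aemeasurable_gain (hf : Continuous f) {u v : Pt d → ℂ}
    {g : Base d → ℂ} (hg : IsBaseTrace A f u v g) {σ : Base d → ℝ}
    (hσ : AEMeasurable σ (volume.restrict A)) :
    AEMeasurable (fun y => (f y + 1 / (2 * σ y))⁻¹ * ‖g y‖ ^ 2) (volume.restrict A) :=
  (((hf.aemeasurable).add ((hσ.const_mul 2).const_div 1)).inv).mul
    (hg.locallyIntegrableOn.aestronglyMeasurable.norm.aemeasurable.pow_const 2)

lemma lintegral_baseSetPos (hA : IsOpen A) {σ : Base d → ℝ}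
    (hσ : AEMeasurable σ (volume.restrict A)) (g : Base d → ℂ) :
    ∫⁻ y in baseSetPos A σ, ENNReal.ofReal (1 / 2 * ((f y + 1 / (2 * σ y))⁻¹ * ‖g y‖ ^ 2)) =
      ∫⁻ y in A, ENNReal.ofReal (baseGain A f σ g y) := by
  rw [← restrict_baseSetPos hA hσ, ← lintegral_indicator₀ (nullMeasurableSet_baseSetPos hA hσ)]
  refine lintegral_congr fun y => ?_
  by_cases hy : y ∈ baseSetPos A σ
  · rw [baseGain, indicator_of_mem hy, indicator_of_mem hy]
  · rw [baseGain, indicator_of_notMem hy, indicator_of_notMem hy, ENNReal.ofReal_zero]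

/-- The Hardy inequality in `[0, ∞]`. -/
theorem IsH1.lintegral_hardy (hA : IsOpen A) (hf : Continuous f) (hfpos : ∀ y ∈ A, 0 < f y)
    {σ : Base d → ℝ} (hσ : AEMeasurable σ (volume.restrict A))
    {u : Pt d → ℂ} {G : Option (Fin d) → Pt d → ℂ} (h : IsH1 (region A f) u G)
    {g : Base d → ℂ} (hg : IsBaseTrace A f u (G none) g) :
    (∫⁻ x in region A f, ENNReal.ofReal (rho A f σ x * ‖u x‖ ^ 2)) +
        (∫⁻ y in baseSetPos A σ,
          ENNReal.ofReal (1 / 2 * ((f y + 1 / (2 * σ y))⁻¹ * ‖g y‖ ^ 2))) +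
        (∫⁻ y in A, ENNReal.ofReal (-(σ y * ‖g y‖ ^ 2))) ≤
      (∫⁻ x in region A f, ENNReal.ofReal (gradSq G x)) +
        (∫⁻ y in A, ENNReal.ofReal (σ y * ‖g y‖ ^ 2)) +
        (∫⁻ x in region A f, ENNReal.ofReal (-(rho A f σ x * ‖u x‖ ^ 2))) := by
  have hAm := hA.measurableSet
  have hρ := aemeasurable_rho_mul hA hf hfpos hσ h.memLp.1
  have hρn : AEMeasurable (fun x => ENNReal.ofReal (-(rho A f σ x * ‖u x‖ ^ 2)))
      (volume.restrict (region A f)) := hρ.neg.ennreal_ofReal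
  have hG := h.integrableOn_gradSq.aemeasurable
  have hB := hg.aemeasurable_sq hσ
  have hBn : AEMeasurable (fun y => ENNReal.ofReal (-(σ y * ‖g y‖ ^ 2))) (volume.restrict A) :=
    hB.neg.ennreal_ofReal
  have hgain : AEMeasurable (fun y => baseGain A f σ g y) (volume.restrict A) :=
    ((hg.aemeasurable_gain hf hσ).const_mul (1 / 2)).indicator₀
      (nullMeasurableSet_baseSetPos hA hσ)
  rw [lintegral_baseSetPos hA hσ, lintegral_region hAm hf hρ.ennreal_ofReal,
    lintegral_region hAm hf hG.ennreal_ofReal, lintegral_region hAm hf hρn,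
    ← lintegral_add_right' _ hgain.ennreal_ofReal, ← lintegral_add_right' _ hBn,
    ← lintegral_add_right' _ hB.ennreal_ofReal,
    ← lintegral_add_right' _ (aemeasurable_lintegral_slice hAm hf hρn)]
  refine lintegral_mono_ae ?_
  filter_upwards [h.ae_fiber_ineq hA hf hfpos hg σ] with y ⟨hu, hGy, hle, _⟩
  simp only [rho_eq_baseWeight, ← neg_mul]
  rw [lintegral_ofReal_const_mul _ hu fun t => sq_nonneg _,
    lintegral_ofReal_const_mul _ hu fun t => sq_nonneg _,
    ← ofReal_integral_eq_lintegral_ofReal hGy (Eventually.of_forall fun t => gradSq_nonneg G _)]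
  rw [neg_mul, neg_mul]
  exact ofReal_move_negative_parts (baseGain_nonneg hfpos σ g y)
    (integral_nonneg fun t => gradSq_nonneg G _) hle

/-- The negative part of the potential term is finite as soon as the boundary term is. -/
lemma IsH1.lintegral_neg_rho_lt_top (hA : IsOpen A) (hf : Continuous f)
    (hfpos : ∀ y ∈ A, 0 < f y) {σ : Base d → ℝ} (hσ : MemLp σ ⊤ (volume.restrict A))
    {u : Pt d → ℂ} {G : Option (Fin d) → Pt d → ℂ} (h : IsH1 (region A f) u G)
    {g : Base d → ℂ} (hg : IsBaseTrace A f u (G none) g)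
    (hB : IntegrableOn (fun y => σ y * ‖g y‖ ^ 2) A) :
    ∫⁻ x in region A f, ENNReal.ofReal (-(rho A f σ x * ‖u x‖ ^ 2)) < ⊤ := by
  have hAm := hA.measurableSet
  have hσm := hσ.1.aemeasurable
  have hρ := aemeasurable_rho_mul hA hf hfpos hσm h.memLp.1
  obtain ⟨C, hC⟩ : ∃ C, ∀ᵐ y ∂volume.restrict A, ‖σ y‖ ≤ C := by
    obtain ⟨C, hC⟩ := (eLpNormEssSup_lt_top_iff_isBoundedUnder.1
      (by simpa using hσ.2))
    refine ⟨C, ?_⟩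
    filter_upwards [hC] with y hy using hy
  have hρn : AEMeasurable (fun x => ENNReal.ofReal (-(rho A f σ x * ‖u x‖ ^ 2)))
      (volume.restrict (region A f)) := hρ.neg.ennreal_ofReal
  rw [lintegral_region hAm hf hρn]
  have hint := (((integrableOn_integral_slice hAm hf h.integrableOn_gradSq).const_mul 8).add
    (hB.abs.const_mul 8)).add ((integrableOn_integral_slice hAm hf
      (integrableOn_sq_norm h.memLp)).const_mul (4 * C ^ 2))
  refine lt_of_le_of_lt (lintegral_mono_ae ?_) hint.lintegral_lt_top
  filter_upwards [h.ae_fiber_ineq hA hf hfpos hg σ, hC] with y ⟨hu, _, _, hle⟩ hCy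
  simp only [rho_eq_baseWeight, ← neg_mul]
  rw [lintegral_ofReal_const_mul _ hu fun t => sq_nonneg _]
  refine ENNReal.ofReal_le_ofReal (hle.trans ?_)
  have h1 : σ y ^ 2 ≤ C ^ 2 := sq_le_sq' (neg_le_of_abs_le hCy) (le_of_abs_le hCy)
  have h2 : 0 ≤ ∫ t in Ioo 0 (f y), ‖u (y, t)‖ ^ 2 := integral_nonneg fun t => sq_nonneg _
  simp only [Pi.add_apply]
  gcongr

/-- The Hardy inequality for functions with integrable boundary term. -/
theorem IsH1.integral_hardy (hA : IsOpen A) (hf : Continuous f) (hfpos : ∀ y ∈ A, 0 < f y)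
    {σ : Base d → ℝ} (hσ : MemLp σ ⊤ (volume.restrict A))
    {u : Pt d → ℂ} {G : Option (Fin d) → Pt d → ℂ} (h : IsH1 (region A f) u G)
    {g : Base d → ℂ} (hg : IsBaseTrace A f u (G none) g)
    (hB : IntegrableOn (fun y => σ y * ‖g y‖ ^ 2) A) :
    IntegrableOn (gradSq G) (region A f) ∧
      IntegrableOn (fun x => rho A f σ x * ‖u x‖ ^ 2) (region A f) ∧
      IntegrableOn (fun y => (f y + 1 / (2 * σ y))⁻¹ * ‖g y‖ ^ 2) (baseSetPos A σ) ∧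
      (∫ x in region A f, gradSq G x) + (∫ y in A, σ y * ‖g y‖ ^ 2) ≥
        (∫ x in region A f, rho A f σ x * ‖u x‖ ^ 2) +
          1 / 2 * ∫ y in baseSetPos A σ, (f y + 1 / (2 * σ y))⁻¹ * ‖g y‖ ^ 2 := by
  have hσm := hσ.1.aemeasurable
  have hρm := aemeasurable_rho_mul hA hf hfpos hσm h.memLp.1
  have hgain : AEMeasurable (fun y => 1 / 2 * ((f y + 1 / (2 * σ y))⁻¹ * ‖g y‖ ^ 2))
      (volume.restrict (baseSetPos A σ)) :=
    ((hg.aemeasurable_gain hf hσm).const_mul (1 / 2)).mono_measure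
      (Measure.restrict_mono (fun y hy => hy.1) le_rfl)
  have hG := h.integrableOn_gradSq
  have hle := h.lintegral_hardy hA hf hfpos hσm hg
  have hneg := h.lintegral_neg_rho_lt_top hA hf hfpos hσ hg hB
  have hGfin := hG.lintegral_lt_top
  have hBpos := hB.lintegral_lt_top
  have hBneg := hB.neg.lintegral_lt_top
  simp only [Pi.neg_apply] at hBneg
  -- The extended inequality itself now yields finiteness of the positive part of `ρ|u|²` and of the
  -- gain.
  have hlhs := hle.trans_lt (ENNReal.add_lt_top.2 ⟨ENNReal.add_lt_top.2 ⟨hGfin, hBpos⟩, hneg⟩)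
  have h1 := (ENNReal.add_lt_top.1 (ENNReal.add_lt_top.1 hlhs).1)
  have hρ : IntegrableOn (fun x => rho A f σ x * ‖u x‖ ^ 2) (region A f) :=
    integrable_of_lintegral_ofReal_lt_top hρm h1.1 hneg
  have hnn : 0 ≤ᵐ[volume.restrict (baseSetPos A σ)]
      fun y => 1 / 2 * ((f y + 1 / (2 * σ y))⁻¹ * ‖g y‖ ^ 2) := by
    rw [EventuallyLE, ← restrict_baseSetPos hA hσm,
      ae_restrict_iff'₀ (nullMeasurableSet_baseSetPos hA hσm)]
    refine Eventually.of_forall fun y hy => ?_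
    have h2 := hfpos y hy.1
    have h3 := hy.2
    simp only [Pi.zero_apply]
    positivity
  have hgi : IntegrableOn (fun y => 1 / 2 * ((f y + 1 / (2 * σ y))⁻¹ * ‖g y‖ ^ 2))
      (baseSetPos A σ) := by
    refine integrable_of_lintegral_ofReal_lt_top hgain h1.2 ?_
    have : ∫⁻ y in baseSetPos A σ,
        ENNReal.ofReal (-(1 / 2 * ((f y + 1 / (2 * σ y))⁻¹ * ‖g y‖ ^ 2))) = 0 := by
      rw [lintegral_congr_ae (g := 0) ?_]
      · exact lintegral_zero
      · filter_upwards [hnn] with y hy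
        exact ENNReal.ofReal_of_nonpos (neg_nonpos.2 hy)
    rw [this]
    exact ENNReal.zero_lt_top
  refine ⟨hG, hρ, ?_, ?_⟩
  · have := hgi.const_mul 2
    refine this.congr (Eventually.of_forall fun y => ?_)
    simp only
    ring
  -- All six terms are finite, so the negative parts can be moved back in `ℝ`.
  · have hr := ENNReal.toReal_mono
      (ENNReal.add_lt_top.2 ⟨ENNReal.add_lt_top.2 ⟨hGfin, hBpos⟩, hneg⟩).ne hle
    rw [ENNReal.toReal_add (ENNReal.add_lt_top.2 h1).ne hBneg.ne,
      ENNReal.toReal_add h1.1.ne h1.2.ne,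
      ENNReal.toReal_add (ENNReal.add_lt_top.2 ⟨hGfin, hBpos⟩).ne hneg.ne,
      ENNReal.toReal_add hGfin.ne hBpos.ne] at hr
    rw [integral_eq_lintegral_pos_part_sub_lintegral_neg_part hB,
      integral_eq_lintegral_pos_part_sub_lintegral_neg_part hρ, ← integral_const_mul,
      integral_eq_lintegral_of_nonneg_ae hnn hgi.1,
      integral_eq_lintegral_of_nonneg_ae (Eventually.of_forall (gradSq_nonneg G)) hG.1]
    linarith

end RobinHardy

theorem mainTheorem8 (d : ℕ) (A : Set (Base d)) (f σ : Base d → ℝ)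
    (hA : IsOpen A) (hf : Continuous f) (hfpos : ∀ y ∈ A, 0 < f y)
    (hfzero : ∀ y ∈ frontier A, f y = 0) (hσ : MemLp σ ⊤ (volume.restrict A)) :
    -- `-μ` is the first positive solution of the implicit equation, and `μ` is the lowest
    -- Robin-Neumann eigenvalue
    (∀ y ∈ baseSetNeg A σ,
      IsLeast (tanhSolutions (f y) (σ y)) (-mu (f y) (σ y)) ∧
      IsLeast {lam | IsRobinNeumannEigenvalue (f y) (σ y) lam} (mu (f y) (σ y))) ∧
    ∀ (u : Pt d → ℂ) (G : Option (Fin d) → Pt d → ℂ), IsH1 (region A f) u G →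
      -- the trace on the base exists
      (∃ g, IsBaseTrace A f u (G none) g) ∧
      ∀ g : Base d → ℂ, IsBaseTrace A f u (G none) g →
        -- the inequality in `[0, ∞]`, with all negative contributions moved to the other side
        ((∫⁻ x in region A f, ENNReal.ofReal (rho A f σ x * ‖u x‖ ^ 2)) +
            (∫⁻ y in baseSetPos A σ,
              ENNReal.ofReal (1 / 2 * ((f y + 1 / (2 * σ y))⁻¹ * ‖g y‖ ^ 2))) +
            (∫⁻ y in A, ENNReal.ofReal (-(σ y * ‖g y‖ ^ 2))) ≤
          (∫⁻ x in region A f, ENNReal.ofReal (gradSq G x)) +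
            (∫⁻ y in A, ENNReal.ofReal (σ y * ‖g y‖ ^ 2)) +
            (∫⁻ x in region A f, ENNReal.ofReal (-(rho A f σ x * ‖u x‖ ^ 2)))) ∧
        -- if the boundary term is finite, all integrals are finite and the inequality is as usual
        (IntegrableOn (fun y => σ y * ‖g y‖ ^ 2) A →
          IntegrableOn (gradSq G) (region A f) ∧
          IntegrableOn (fun x => rho A f σ x * ‖u x‖ ^ 2) (region A f) ∧
          IntegrableOn (fun y => (f y + 1 / (2 * σ y))⁻¹ * ‖g y‖ ^ 2) (baseSetPos A σ) ∧
          (∫ x in region A f, gradSq G x) + (∫ y in A, σ y * ‖g y‖ ^ 2) ≥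
            (∫ x in region A f, rho A f σ x * ‖u x‖ ^ 2) +
              1 / 2 * ∫ y in baseSetPos A σ, (f y + 1 / (2 * σ y))⁻¹ * ‖g y‖ ^ 2) := by
  refine ⟨fun y hy => ⟨isLeast_tanhSolutions (hfpos y hy.1) hy.2,
    isRobinNeumannEigenvalue_mu (hfpos y hy.1) hy.2,
    fun _ h => mu_le_of_isRobinNeumannEigenvalue (hfpos y hy.1) hy.2 h⟩, fun u G hu => ⟨?_, ?_⟩⟩
  · obtain ⟨g, hg, -⟩ := hu.exists_trace hA hf hfpos
    exact ⟨g, hg⟩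
  · exact fun g hg => ⟨hu.lintegral_hardy hA hf hfpos hσ.1.aemeasurable hg,
      hu.integral_hardy hA hf hfpos hσ hg⟩
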